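/- **Model.** Let $V$ be a finite set of anonymous nodes, each with ports $\{0,\dots,\Delta-1\}$. A dynamic network is an arbitrary infinite sequence $G_0,G_1,\dots$ of simple undirected graphs on $V$; in each stage $t$ every edge of $G_t$ occupies one port at each of its two ends, and distinct edges at a node occupy distinct ports (so degrees are at most $\Delta$; nothing else is assumed on the dynamics). An edge leaving its port, at either end, between stages $t-1$ and $t$ is a disconnection: the ports concerned are added, at the beginning of stage $t$, to the sets $D$ of their nodes. $N(u)$ is the set of occupied ports of $u$ in the current stage. A synchronous algorithm $\mathcal A$ consists of guarded actions (possibly several enabled at once). The state of a node consists of a main state and one state per port; guards and operations depend on the node's state and on what it has pulled, i.e. for each port in use the main state of the neighbour and the state of the neighbour's port at the other end of the edge. In a synchronous execution of $\mathcal A$ under a dynamic network $\mathcal G_{synch}$, in every stage every node simultaneously executes one enabled action (and does nothing if none is enabled). It *terminates in finite time* if from some stage on no action of $\mathcal A$ is enabled at any node. **The synchronizer $\kappa(\mathcal A)$.** Besides its $\mathcal A$-state, each node stores $\mathtt{phase}\in\mathbb N$, $\mathtt{synch}\in\{0,1\}$, flags $\ell.\mathtt{block},\ell.\mathtt{ack}\in\{0,1\}$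 for each port $\ell$, sets $I,P,D,\tilde D,F$ of ports, and the data $X(\ell)$ last pulled through each port $\ell$; initially numbers and flags are $0$, sets are empty and nothing has been pulled. A pull through $\ell$ returns the neighbour's main variables ($\mathtt{phase},\mathtt{synch},P,\tilde D,D$, main $\mathcal A$-state) and the variables of the neighbour's port at the other end of the edge ($\mathtt{ack}$, the label $\mathtt{port}$, the $\mathcal A$-state of the port). There are two actions. * HANDSHAKE, with guard: $\mathtt{synch}=0$ or $\ell.\mathtt{block}=0$ for some $\ell\in P\setminus\tilde D$. If $\mathtt{synch}=0$: pull $X(\ell)$ for all $\ell\in N(u)$; put $\tilde D=\emptyset$; let $I$ be the set of $\ell\in N(u)$ such that $X(\ell).\mathtt{phase}>\mathtt{phase}$, or $X(\ell).\mathtt{phase}=\mathtt{phase}$, $X(\ell).\mathtt{synch}=1$ and ($X(\ell).\mathtt{port}\notin X(\ell).P$ or $X(\ell).\mathtt{port}\in X(\ell).\tilde D\cup X(\ell).D$); put $P=N(u)\setminus I$ and $\mathtt{synch}=1$. If $\mathtt{synch}=1$: for $\ell\in P\setminus(\tilde D\cup D)$ pull all of $X(\ell)$ if the stored $X(\ell).\mathtt{phase}<\mathtt{phase}$,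 and only $X(\ell).\mathtt{ack}$ otherwise; then put $\tilde D=\tilde D\cup D$. In both cases, finally, for each $\ell\in P\setminus\tilde D$ with $X(\ell).\mathtt{phase}=\mathtt{phase}$ and $\ell.\mathtt{block}=0$: if $X(\ell).\mathtt{ack}=1$, set to $1$ the $\mathtt{block}$ flag of the neighbour's port at the other end of the edge, and $\ell.\mathtt{block}$; otherwise set $\ell.\mathtt{ack}=1$. * EXECUTESYNCH, with guard: $\mathtt{synch}=1$ and $\ell.\mathtt{block}=1$ for all $\ell\in P\setminus\tilde D$. Put $F=\{\ell\in P:\ell.\mathtt{block}=1\}$; execute an enabled action of $\mathcal A$ (if there is one) with respect to the stored data $X(\ell)$, $\ell\in F$; increase $\mathtt{phase}$ by $1$; set $\mathtt{synch}$ and all $\mathtt{ack}$ and $\mathtt{block}$ flags to $0$. In a semi-synchronous execution of $\kappa(\mathcal A)$ under a dynamic network $\mathcal G_{semi}$, in each stage the scheduler activates an arbitrary (possibly empty) set of enabled nodes; these simultaneously execute an enabled action, all reads of a stage preceding all its writes, and $D$ is reset to $\emptyset$ at the end of each activation of the node. The scheduler is *weakly fair* if every node that is continuously enabled from some stage on is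 activated at that stage or later. The execution *terminates in finite time* if from some stage on no node executes an action of the simulated algorithm $\mathcal A$ (the synchronizer itself always has an enabled action). **Theorem (Finite termination).** Let $\mathcal A$ be a synchronous algorithm, and fix arbitrary initial $\mathcal A$-states of the nodes. 1. In every semi-synchronous execution of $\kappa(\mathcal A)$, under any dynamic network and any weakly fair scheduler, every node reaches phase $i$ after finitely many stages, for every $i\ge 0$. Moreover, whenever the minimum phase over all nodes is $i$ at the start of some stage, it is $i+1$ at the start of some later stage. 2. All synchronous executions of $\mathcal A$ (under all dynamic networks $\mathcal G_{synch}$) terminate in finite time if and only if all semi-synchronous executions of $\kappa(\mathcal A)$ (under all dynamic networks $\mathcal G_{semi}$ and all weakly fair schedulers) terminate in finite time. -/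

import Mathlib

/-- A snapshot of a network of maximum degree at most `Δ` on the node set `V`, with port labels.
`link u ℓ = some (v, m)` means that port `ℓ` of `u` is occupied by an edge `{u, v}` whose other end
is at port `m` of `v`; `link u ℓ = none` means that port `ℓ` of `u` is free. The communication graph
is the simple undirected graph of all pairs `{u, v}` joined in this way. -/
@[ext]
structure Snapshot (V : Type*) (Δ : ℕ) where
  link : V → Fin Δ → Option (V × Fin Δ)
  symm : ∀ u ℓ v m, link u ℓ = some (v, m) → link v m = some (u, ℓ)
  loopless : ∀ u ℓ m, link u ℓ ≠ some (u, m)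
  simple : ∀ u v ℓ m ℓ' m', link u ℓ = some (v, m) → link u ℓ' = some (v, m') → ℓ = ℓ'

/-- The ports of `u` at which an edge of `G` is no longer present in `G'`. -/
def Snapshot.lost {V : Type*} {Δ : ℕ} (G G' : Snapshot V Δ) (u : V) : Set (Fin Δ) :=
  {ℓ | G.link u ℓ ≠ none ∧ G'.link u ℓ ≠ G.link u ℓ}

/-- The state of a node of a synchronous algorithm: its main state and the state of each port. -/
abbrev AlgState (Δ : ℕ) (Main Port : Type*) := Main × (Fin Δ → Port)

/-- What a node has pulled from its neighbours: for each port in use, the main state of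
the neighbour and the state of the neighbour's port at the other end of the edge. -/
abbrev AlgView (Δ : ℕ) (Main Port : Type*) := Fin Δ → Option (Main × Port)

/-- An anonymous algorithm in the PULL model, given by guarded actions (all nodes run the same
actions and see their neighbours only through ports). -/
structure SyncAlgorithm (Δ : ℕ) (Main Port Act : Type*) where
  guard : Act → AlgState Δ Main Port → AlgView Δ Main Port → Prop
  op : Act → AlgState Δ Main Port → AlgView Δ Main Port → AlgState Δ Main Port

namespace SyncAlgorithm

variable {Δ : ℕ} {Main Port Act : Type*}

/-- Some action is enabled. -/
def Enabled (A : SyncAlgorithm Δ Main Port Act) (s : AlgState Δ Main Port)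
    (w : AlgView Δ Main Port) : Prop :=
  ∃ a, A.guard a s w

/-- One step of a node: it executes one enabled action, and does nothing if there is none. -/
def Step (A : SyncAlgorithm Δ Main Port Act) (s : AlgState Δ Main Port)
    (w : AlgView Δ Main Port) (s' : AlgState Δ Main Port) : Prop :=
  (∃ a, A.guard a s w ∧ s' = A.op a s w) ∨ (¬ A.Enabled s w ∧ s' = s)

end SyncAlgorithm

/-- What node `u` pulls in the snapshot `G` when the nodes are in the states `c`. -/
def syncView {V : Type*} {Δ : ℕ} {Main Port : Type*} (G : Snapshot V Δ)
    (c : V → AlgState Δ Main Port) (u : V) : AlgView Δ Main Port :=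
  fun ℓ => (G.link u ℓ).map fun q => ((c q.1).1, (c q.1).2 q.2)

/-- A synchronous execution of `A` from the initial states `x₀`, under the dynamic
network `net`: in every stage, every node performs one step. -/
structure SyncExecution {V : Type*} {Δ : ℕ} {Main Port Act : Type*}
    (A : SyncAlgorithm Δ Main Port Act) (x₀ : V → AlgState Δ Main Port) where
  net : ℕ → Snapshot V Δ
  state : ℕ → V → AlgState Δ Main Port
  init : state 0 = x₀
  step : ∀ t u, A.Step (state t u) (syncView (net t) (state t) u) (state (t + 1) u)

/-- After finitely many stages, no action is enabled at any node any more. -/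
def SyncExecution.Terminates {V : Type*} {Δ : ℕ} {Main Port Act : Type*}
    {A : SyncAlgorithm Δ Main Port Act} {x₀ : V → AlgState Δ Main Port}
    (e : SyncExecution A x₀) : Prop :=
  ∃ T, ∀ t, T ≤ t → ∀ u, ¬ A.Enabled (e.state t u) (syncView (e.net t) (e.state t) u)

/-- The data obtained by a PULL through a port from the neighbour `v` at its other end: the
main state of `v` and the state of the port of `v` that the edge uses (`ack`, `port`, `algPort`). -/
structure Pulled (Δ : ℕ) (Main Port : Type*) where
  phase : ℕ
  synch : Bool
  P : Set (Fin Δ)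
  Dt : Set (Fin Δ)
  D : Set (Fin Δ)
  ack : Bool
  port : Fin Δ
  algMain : Main
  algPort : Port

/-- The memory of a node that runs the synchronizer. `Dt` is the set written `D` with a tilde (ports
that were disconnected during the current phase), `D` is the disconnection detector,
`X ℓ` is the data last pulled through port `ℓ` (`none` if there was no pull yet), and `alg` is the
state of the simulated algorithm. -/
structure KState (Δ : ℕ) (Main Port : Type*) where
  phase : ℕ
  synch : Bool
  block : Fin Δ → Bool
  ack : Fin Δ → Bool
  I : Set (Fin Δ)
  P : Set (Fin Δ)
  D : Set (Fin Δ)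
  Dt : Set (Fin Δ)
  F : Set (Fin Δ)
  X : Fin Δ → Option (Pulled Δ Main Port)
  alg : AlgState Δ Main Port

namespace KState

variable {Δ : ℕ} {Main Port Act : Type*}

/-- The initial memory of a node whose simulated algorithm starts in the state `x`. -/
def initial (x : AlgState Δ Main Port) : KState Δ Main Port where
  phase := 0
  synch := false
  block := fun _ => false
  ack := fun _ => false
  I := ∅
  P := ∅
  D := ∅
  Dt := ∅
  F := ∅
  X := fun _ => none
  alg := x

/-- What a neighbour reads when it pulls from a node in state `s` through port `m` of that node. -/
def expose (s : KState Δ Main Port) (m : Fin Δ) : Pulled Δ Main Port where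
  phase := s.phase
  synch := s.synch
  P := s.P
  Dt := s.Dt
  D := s.D
  ack := s.ack m
  port := m
  algMain := s.alg.1
  algPort := s.alg.2 m

/-- Guard of the action HANDSHAKE. -/
def HandshakeGuard (s : KState Δ Main Port) : Prop :=
  s.synch = false ∨ ∃ ℓ ∈ s.P \ s.Dt, s.block ℓ = false

/-- Guard of the action EXECUTESYNCH. -/
def ExecuteGuard (s : KState Δ Main Port) : Prop :=
  s.synch = true ∧ ∀ ℓ ∈ s.P \ s.Dt, s.block ℓ = true

/-- The node has an enabled action. -/
def Enabled (s : KState Δ Main Port) : Prop :=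
  s.HandshakeGuard ∨ s.ExecuteGuard

/-- The invalid ports at the first activation in a phase. The argument `pull ℓ` is the
data available through port `ℓ` in the current stage (`none` if the port is free). -/
def invalid (s : KState Δ Main Port) (pull : Fin Δ → Option (Pulled Δ Main Port)) :
    Set (Fin Δ) :=
  {ℓ | ∃ x, pull ℓ = some x ∧
    ((x.phase = s.phase ∧ x.synch = true ∧ (x.port ∉ x.P ∨ x.port ∈ x.Dt ∪ x.D)) ∨
      s.phase < x.phase)}

/-- First branch of HANDSHAKE (`synch = 0`): pull through all occupied ports
and initialize the sets `I`, `P` of the phase. -/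
def startPhase (s : KState Δ Main Port) (pull : Fin Δ → Option (Pulled Δ Main Port)) :
    KState Δ Main Port :=
  { s with
    X := fun ℓ => (pull ℓ).or (s.X ℓ)
    Dt := ∅
    I := s.invalid pull
    P := {ℓ | pull ℓ ≠ none} \ s.invalid pull
    synch := true }

open Classical in
/-- Second branch of HANDSHAKE (`synch = 1`): refresh the pulled data at the ports that are
still valid, and record the disconnections. (A port in `P \ (Dt ∪ D)` is always occupied and has
been pulled from, so the last case of the `match` does not arise there.) -/
noncomputable def refresh (s : KState Δ Main Port)
    (pull : Fin Δ → Option (Pulled Δ Main Port)) : KState Δ Main Port :=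
  { s with
    X := fun ℓ =>
      if ℓ ∈ s.P \ (s.Dt ∪ s.D) then
        match s.X ℓ, pull ℓ with
        | some x, some y => if x.phase < s.phase then some y else some { x with ack := y.ack }
        | _, _ => s.X ℓ
      else s.X ℓ
    Dt := s.Dt ∪ s.D }

/-- The part of HANDSHAKE before its final loop. -/
noncomputable def prepare (s : KState Δ Main Port)
    (pull : Fin Δ → Option (Pulled Δ Main Port)) : KState Δ Main Port :=
  if s.synch = false then s.startPhase pull else s.refresh pull

/-- The ports that the final loop of HANDSHAKE visits with `X(ℓ).ack = a`. -/
def loopPorts (s : KState Δ Main Port) (a : Bool) : Set (Fin Δ) :=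
  {ℓ | ℓ ∈ s.P \ s.Dt ∧ s.block ℓ = false ∧ ∃ x, s.X ℓ = some x ∧ x.phase = s.phase ∧ x.ack = a}

/-- The ports through which HANDSHAKE performs the operation BLOCK, i.e. sets the `block` flag at
the neighbour's end of the edge. -/
noncomputable def blockPorts (s : KState Δ Main Port)
    (pull : Fin Δ → Option (Pulled Δ Main Port)) : Set (Fin Δ) :=
  (s.prepare pull).loopPorts true

open Classical in
/-- Effect of HANDSHAKE on the memory of the node itself. The disconnection detector is reset at
the end of the activation. -/
noncomputable def handshake (s : KState Δ Main Port)
    (pull : Fin Δ → Option (Pulled Δ Main Port)) : KState Δ Main Port :=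
  let s' := s.prepare pull
  { s' with
    block := fun ℓ => if ℓ ∈ s'.loopPorts true then true else s'.block ℓ
    ack := fun ℓ => if ℓ ∈ s'.loopPorts false then true else s'.ack ℓ
    D := ∅ }

/-- The set `F` computed by EXECUTESYNCH. -/
def finalPorts (s : KState Δ Main Port) : Set (Fin Δ) :=
  {ℓ | ℓ ∈ s.P ∧ s.block ℓ = true}

open Classical in
/-- The view with respect to which EXECUTESYNCH runs an action of the simulated
algorithm: the stored pulled states at the ports in `F`. -/
noncomputable def simView (s : KState Δ Main Port) : AlgView Δ Main Port :=
  fun ℓ => if ℓ ∈ s.finalPorts then (s.X ℓ).map fun x => (x.algMain, x.algPort) else none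

/-- Effect of EXECUTESYNCH, when the action of the simulated algorithm
leads to its new state `y`. -/
def execute (s : KState Δ Main Port) (y : AlgState Δ Main Port) : KState Δ Main Port :=
  { s with
    F := s.finalPorts
    alg := y
    phase := s.phase + 1
    synch := false
    ack := fun _ => false
    block := fun _ => false
    D := ∅ }

/-- Effect of an activation on the memory of the node itself: one enabled action is executed. -/
def Activation (A : SyncAlgorithm Δ Main Port Act)
    (pull : Fin Δ → Option (Pulled Δ Main Port)) (s s' : KState Δ Main Port) : Prop :=
  (s.HandshakeGuard ∧ s' = s.handshake pull) ∨
    (s.ExecuteGuard ∧ ∃ y, A.Step s.alg s.simView y ∧ s' = s.execute y)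

end KState

/-- What node `u` can pull in the snapshot `G` when the nodes have the memories `c`. -/
def kPull {V : Type*} {Δ : ℕ} {Main Port : Type*} (G : Snapshot V Δ)
    (c : V → KState Δ Main Port) (u : V) : Fin Δ → Option (Pulled Δ Main Port) :=
  fun ℓ => (G.link u ℓ).map fun q => (c q.1).expose q.2

/-- Some activated neighbour performs BLOCK on the edge at port `ℓ` of `u`. -/
def BlockedByNeighbor {V : Type*} {Δ : ℕ} {Main Port : Type*} (G : Snapshot V Δ)
    (act : Set V) (c : V → KState Δ Main Port) (u : V) (ℓ : Fin Δ) : Prop :=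
  ∃ v m, G.link v m = some (u, ℓ) ∧ v ∈ act ∧ (c v).HandshakeGuard ∧
    m ∈ (c v).blockPorts (kPull G c v)

open Classical in
/-- A semi-synchronous execution of the synchronizer applied to `A`, with initial states
`x₀` of the simulated algorithm, under the dynamic network `net`; `active t` is the set of nodes
activated in stage `t`. The memory `cfg t u` is the one at the start of stage `t`,
when the disconnections at the beginning of stage `t` have already been detected. Within a stage all
reads precede all writes. -/
structure SemiExecution {V : Type*} {Δ : ℕ} {Main Port Act : Type*}
    (A : SyncAlgorithm Δ Main Port Act) (x₀ : V → AlgState Δ Main Port) where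
  net : ℕ → Snapshot V Δ
  active : ℕ → Set V
  cfg : ℕ → V → KState Δ Main Port
  init : cfg 0 = fun u => KState.initial (x₀ u)
  active_enabled : ∀ t u, u ∈ active t → (cfg t u).Enabled
  step : ∀ t u, ∃ s : KState Δ Main Port,
    (u ∈ active t → (cfg t u).Activation A (kPull (net t) (cfg t) u) s) ∧
    (u ∉ active t → s = cfg t u) ∧
    cfg (t + 1) u =
      { s with
        block := fun ℓ =>
          if BlockedByNeighbor (net t) (active t) (cfg t) u ℓ then true else s.block ℓ
        D := s.D ∪ (net t).lost (net (t + 1)) u }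

namespace SemiExecution

variable {V : Type*} {Δ : ℕ} {Main Port Act : Type*} {A : SyncAlgorithm Δ Main Port Act}
  {x₀ : V → AlgState Δ Main Port}

/-- The scheduler is weakly fair: a node that is continuously enabled from
some stage on is activated at that stage or later. -/
def WeaklyFair (e : SemiExecution A x₀) : Prop :=
  ∀ u t, (∀ t', t ≤ t' → (e.cfg t' u).Enabled) → ∃ t', t ≤ t' ∧ u ∈ e.active t'

/-- In stage `t`, node `u` executes EXECUTESYNCH and an action of the simulated algorithm
is enabled in it (and thus executed). -/
def RunsAction (e : SemiExecution A x₀) (t : ℕ) (u : V) : Prop :=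
  u ∈ e.active t ∧ (e.cfg t u).ExecuteGuard ∧ A.Enabled (e.cfg t u).alg (e.cfg t u).simView

/-- After finitely many stages, no node executes an action of the simulated algorithm any more.
(The synchronizer's own two actions never stop, as one of them is always enabled.) -/
def Terminates (e : SemiExecution A x₀) : Prop :=
  ∃ T, ∀ t, T ≤ t → ∀ u, ¬ e.RunsAction t u

/-- `i` is the smallest phase number of a node at the start of stage `t`. -/
def IsMinPhase (e : SemiExecution A x₀) (t i : ℕ) : Prop :=
  IsLeast (Set.range fun u => (e.cfg t u).phase) i

end SemiExecution

/-! The core is an invariant of executions, `Consistent`, whose clause on edges is `Compatible`.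
Take a node that has started its phase and a port that it still regards as valid. If the neighbour
is in an earlier phase, or has not yet started the same phase, the port is unblocked. If the
neighbour has started the same phase, it regards the edge as valid too, and the `block` flags of the
two ends agree. The neighbour can be ahead by one phase at most, and only if the port is blocked.
This persists because BLOCK always hits a neighbour in the same phase, at a valid and unblocked port
(`Consistent.blocks_spec`), so that both flags rise in the same stage, and because EXECUTESYNCH
needs all valid ports blocked.

Progress: let a node of minimum phase never leave that phase. A port that remained valid and
unblocked forever would, by the invariant, keep the neighbour in the same phase. By fairness both
ends would start the phase, one would set `ack`, and the other would read it and perform BLOCK, a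
contradiction (`eventually_settled`). Hence each of the finitely many ports is eventually
disconnected or blocked, and EXECUTESYNCH becomes the enabled action (`exists_phase_succ`).

Equivalence: a fair execution simulates the synchronous one (`toSync`) whose graph in stage `i`
consists of the edges over which BLOCK occurs in phase `i`. Such an edge was present when either end
started the phase. The ports used by EXECUTESYNCH are exactly those of this graph, and the data
stored there are current because the simulated state changes only with the phase
(`Executes.simView_eq`). Conversely, a synchronous execution is simulated in lockstep (`toSemi`) by
keeping every graph for three stages: set `ack`, BLOCK, execute. Both simulations preserve views,
hence enabledness, hence termination. -/

namespace KState

/-! ### Guards and the relation between the two ends of an edge -/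

variable {Δ : ℕ} {Main Port Act : Type*}

/-- The ports that take part in the current phase and have not been disconnected during it. -/
def valid (s : KState Δ Main Port) : Set (Fin Δ) := s.P \ (s.Dt ∪ s.D)

/-- Since some action is always enabled, weak fairness amounts to activating every node infinitely
often. -/
theorem handshakeGuard_or_executeGuard (s : KState Δ Main Port) : s.Enabled := by
  unfold Enabled HandshakeGuard ExecuteGuard
  by_cases h : ∃ ℓ ∈ s.P \ s.Dt, s.block ℓ = false
  · exact Or.inl (Or.inr h)
  · push Not at h
    cases hs : s.synch
    · simp
    · refine Or.inr ⟨rfl, fun ℓ hℓ => ?_⟩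
      simpa using h ℓ hℓ

theorem not_executeGuard_of_handshakeGuard {s : KState Δ Main Port} (h : s.HandshakeGuard) :
    ¬ s.ExecuteGuard := by
  rintro ⟨h1, h2⟩
  rcases h with h | ⟨ℓ, hℓ, h⟩
  · simp [h1] at h
  · simp [h2 ℓ hℓ] at h

/-- The relation between the two ends of an edge, seen from the end at port `ℓ` of `s`,
where it is valid. -/
def Compatible (s : KState Δ Main Port) (ℓ : Fin Δ) (r : KState Δ Main Port) (m : Fin Δ) : Prop :=
  (r.phase < s.phase ∧ s.block ℓ = false) ∨
  (r.phase = s.phase ∧ r.synch = false ∧ s.block ℓ = false) ∨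
  (r.phase = s.phase ∧ r.synch = true ∧ m ∈ r.valid ∧ s.block ℓ = r.block m) ∨
  (r.phase = s.phase + 1 ∧ s.block ℓ = true ∧ (r.synch = false ∨ m ∈ r.valid))

end KState

/-! ### The four kinds of stages of a node -/

namespace SemiExecution

variable {V : Type*} {Δ : ℕ} {Main Port Act : Type*} {A : SyncAlgorithm Δ Main Port Act}
  {x₀ : V → AlgState Δ Main Port} (e : SemiExecution A x₀)

/-- In stage `t`, node `v` performs BLOCK through its port `m`. -/
def Blocks (t : ℕ) (v : V) (m : Fin Δ) : Prop :=
  v ∈ e.active t ∧ (e.cfg t v).HandshakeGuard ∧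
    m ∈ (e.cfg t v).blockPorts (kPull (e.net t) (e.cfg t) v)

theorem blockedByNeighbor_iff {t : ℕ} {u v : V} {ℓ m : Fin Δ}
    (h : (e.net t).link u ℓ = some (v, m)) :
    BlockedByNeighbor (e.net t) (e.active t) (e.cfg t) u ℓ ↔ e.Blocks t v m := by
  constructor
  · rintro ⟨v', m', h', hb⟩
    have := (e.net t).symm _ _ _ _ h'
    rw [h] at this
    obtain ⟨rfl, rfl⟩ : v = v' ∧ m = m' := by simpa using this
    exact hb
  · intro hb
    exact ⟨v, m, (e.net t).symm _ _ _ _ h, hb⟩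

theorem exists_blocks_of_blockedByNeighbor {t : ℕ} {u : V} {ℓ : Fin Δ}
    (h : BlockedByNeighbor (e.net t) (e.active t) (e.cfg t) u ℓ) :
    ∃ v m, (e.net t).link u ℓ = some (v, m) ∧ e.Blocks t v m := by
  obtain ⟨v, m, hl, hb⟩ := h
  exact ⟨v, m, (e.net t).symm _ _ _ _ hl, hb⟩

/-- Port `ℓ` of `u` is visited in stage `t` by the final loop of HANDSHAKE, with the value `a`
of the pulled `ack` flag; expressed through the memory of `u` after the stage. -/
def Visits (t : ℕ) (u : V) (ℓ : Fin Δ) (a : Bool) : Prop :=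
  ℓ ∈ (e.cfg (t + 1) u).P \ (e.cfg (t + 1) u).Dt ∧ (e.cfg t u).block ℓ = false ∧
    ∃ x, (e.cfg (t + 1) u).X ℓ = some x ∧ x.phase = (e.cfg t u).phase ∧ x.ack = a

/-- The node is not activated. -/
structure Idle (t : ℕ) (u : V) : Prop where
  inactive : u ∉ e.active t
  phase : (e.cfg (t + 1) u).phase = (e.cfg t u).phase
  synch : (e.cfg (t + 1) u).synch = (e.cfg t u).synch
  ack : (e.cfg (t + 1) u).ack = (e.cfg t u).ack
  P : (e.cfg (t + 1) u).P = (e.cfg t u).P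
  Dt : (e.cfg (t + 1) u).Dt = (e.cfg t u).Dt
  D : (e.cfg (t + 1) u).D = (e.cfg t u).D ∪ (e.net t).lost (e.net (t + 1)) u
  X : (e.cfg (t + 1) u).X = (e.cfg t u).X
  alg : (e.cfg (t + 1) u).alg = (e.cfg t u).alg
  block : ∀ ℓ, (e.cfg (t + 1) u).block ℓ = true ↔ (e.cfg t u).block ℓ = true ∨
    BlockedByNeighbor (e.net t) (e.active t) (e.cfg t) u ℓ

/-- The node executes the first branch of HANDSHAKE. -/
structure Starts (t : ℕ) (u : V) : Prop where
  active : u ∈ e.active t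
  synch₀ : (e.cfg t u).synch = false
  phase : (e.cfg (t + 1) u).phase = (e.cfg t u).phase
  synch : (e.cfg (t + 1) u).synch = true
  ack : ∀ ℓ, (e.cfg (t + 1) u).ack ℓ = true ↔ (e.cfg t u).ack ℓ = true ∨
    e.Visits t u ℓ false
  blocks : ∀ ℓ, e.Blocks t u ℓ ↔ e.Visits t u ℓ true
  P : (e.cfg (t + 1) u).P = {ℓ | (e.net t).link u ℓ ≠ none} \
    (e.cfg t u).invalid (kPull (e.net t) (e.cfg t) u)
  Dt : (e.cfg (t + 1) u).Dt = ∅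
  D : (e.cfg (t + 1) u).D = (e.net t).lost (e.net (t + 1)) u
  X : ∀ ℓ, (e.cfg (t + 1) u).X ℓ =
    ((e.net t).link u ℓ).elim ((e.cfg t u).X ℓ) fun q => some ((e.cfg t q.1).expose q.2)
  alg : (e.cfg (t + 1) u).alg = (e.cfg t u).alg
  block : ∀ ℓ, (e.cfg (t + 1) u).block ℓ = true ↔ (e.cfg t u).block ℓ = true ∨
    e.Blocks t u ℓ ∨ BlockedByNeighbor (e.net t) (e.active t) (e.cfg t) u ℓ

/-- The node executes the second branch of HANDSHAKE. -/
structure Refreshes (t : ℕ) (u : V) : Prop where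
  active : u ∈ e.active t
  guard : (e.cfg t u).HandshakeGuard
  synch₀ : (e.cfg t u).synch = true
  phase : (e.cfg (t + 1) u).phase = (e.cfg t u).phase
  synch : (e.cfg (t + 1) u).synch = true
  ack : ∀ ℓ, (e.cfg (t + 1) u).ack ℓ = true ↔ (e.cfg t u).ack ℓ = true ∨
    e.Visits t u ℓ false
  blocks : ∀ ℓ, e.Blocks t u ℓ ↔ e.Visits t u ℓ true
  P : (e.cfg (t + 1) u).P = (e.cfg t u).P
  Dt : (e.cfg (t + 1) u).Dt = (e.cfg t u).Dt ∪ (e.cfg t u).D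
  D : (e.cfg (t + 1) u).D = (e.net t).lost (e.net (t + 1)) u
  X : (e.cfg (t + 1) u).X = ((e.cfg t u).refresh (kPull (e.net t) (e.cfg t) u)).X
  alg : (e.cfg (t + 1) u).alg = (e.cfg t u).alg
  block : ∀ ℓ, (e.cfg (t + 1) u).block ℓ = true ↔ (e.cfg t u).block ℓ = true ∨
    e.Blocks t u ℓ ∨ BlockedByNeighbor (e.net t) (e.active t) (e.cfg t) u ℓ

/-- The node executes EXECUTESYNCH. -/
structure Executes (t : ℕ) (u : V) : Prop where
  active : u ∈ e.active t
  guard : (e.cfg t u).ExecuteGuard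
  phase : (e.cfg (t + 1) u).phase = (e.cfg t u).phase + 1
  synch : (e.cfg (t + 1) u).synch = false
  ack : ∀ ℓ, (e.cfg (t + 1) u).ack ℓ = false
  alg : A.Step (e.cfg t u).alg (e.cfg t u).simView (e.cfg (t + 1) u).alg
  block : ∀ ℓ, (e.cfg (t + 1) u).block ℓ = true ↔
    BlockedByNeighbor (e.net t) (e.active t) (e.cfg t) u ℓ

/-- The only place where the field `step` of a general execution is unfolded; later arguments work
with the four records. -/
theorem stage_cases (t : ℕ) (u : V) :
    e.Idle t u ∨ e.Starts t u ∨ e.Refreshes t u ∨ e.Executes t u := by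
  classical
  obtain ⟨s, h1, h2, h3⟩ := e.step t u
  by_cases hu : u ∈ e.active t
  · rcases h1 hu with ⟨hg, rfl⟩ | ⟨hg, y, hy, rfl⟩
    · cases hs : (e.cfg t u).synch
      -- The final loop of HANDSHAKE changes neither `P`, `Dt`, `X` nor `phase`, so the ports it
      -- visits can be read off from the memory after the stage; only `block` must be taken before
      -- it.
      · have hv : ∀ ℓ a, e.Visits t u ℓ a ↔
            ℓ ∈ ((e.cfg t u).startPhase (kPull (e.net t) (e.cfg t) u)).loopPorts a := by
          intro ℓ a
          unfold Visits
          rw [h3]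
          simp only [KState.handshake, KState.prepare, hs, if_true]
          rfl
        have hb : ∀ ℓ, e.Blocks t u ℓ ↔ e.Visits t u ℓ true := by
          intro ℓ
          simp [hv, Blocks, KState.blockPorts, KState.prepare, hs, hu, hg]
        have hr : ((e.cfg t u).startPhase (kPull (e.net t) (e.cfg t) u)).block =
            (e.cfg t u).block := rfl
        have hr' : ((e.cfg t u).startPhase (kPull (e.net t) (e.cfg t) u)).ack =
            (e.cfg t u).ack := rfl
        refine Or.inr (Or.inl ⟨hu, hs, ?_, ?_, ?_, hb, ?_, ?_, ?_, ?_, ?_, ?_⟩)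
        · simp [h3, KState.handshake, KState.prepare, hs, KState.startPhase]
        · simp [h3, KState.handshake, KState.prepare, hs, KState.startPhase]
        · intro ℓ
          simp only [h3, KState.handshake, KState.prepare, hs, if_true, hv, hr']
          split_ifs with h <;> simp [h]
        · simp [h3, KState.handshake, KState.prepare, hs, KState.startPhase, kPull]
        · simp [h3, KState.handshake, KState.prepare, hs, KState.startPhase]
        · simp [h3, KState.handshake, KState.prepare, hs, KState.startPhase]
        · intro ℓ
          simp only [h3, KState.handshake, KState.prepare, hs, if_true, KState.startPhase, kPull]
          cases (e.net t).link u ℓ <;> simp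
        · simp [h3, KState.handshake, KState.prepare, hs, KState.startPhase]
        · intro ℓ
          rw [hb, hv]
          simp only [h3, KState.handshake, KState.prepare, hs, if_true, hr]
          split_ifs with h h' <;> simp [*]
      · have hv : ∀ ℓ a, e.Visits t u ℓ a ↔
            ℓ ∈ ((e.cfg t u).refresh (kPull (e.net t) (e.cfg t) u)).loopPorts a := by
          intro ℓ a
          unfold Visits
          rw [h3]
          simp only [KState.handshake, KState.prepare, hs, Bool.true_eq_false, if_false]
          rfl
        have hb : ∀ ℓ, e.Blocks t u ℓ ↔ e.Visits t u ℓ true := by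
          intro ℓ
          simp [hv, Blocks, KState.blockPorts, KState.prepare, hs, hu, hg]
        have hr : ((e.cfg t u).refresh (kPull (e.net t) (e.cfg t) u)).block =
            (e.cfg t u).block := rfl
        have hr' : ((e.cfg t u).refresh (kPull (e.net t) (e.cfg t) u)).ack =
            (e.cfg t u).ack := rfl
        refine Or.inr (Or.inr (Or.inl ⟨hu, hg, hs, ?_, ?_, ?_, hb, ?_, ?_, ?_, ?_, ?_, ?_⟩))
        · simp [h3, KState.handshake, KState.prepare, hs, KState.refresh]
        · simp [h3, KState.handshake, KState.prepare, hs, KState.refresh]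
        · intro ℓ
          simp only [h3, KState.handshake, KState.prepare, hs, Bool.true_eq_false, if_false, hv,
            hr']
          split_ifs with h <;> simp [h]
        · simp [h3, KState.handshake, KState.prepare, hs, KState.refresh]
        · simp [h3, KState.handshake, KState.prepare, hs, KState.refresh]
        · simp [h3, KState.handshake, KState.prepare, hs, KState.refresh]
        · simp [h3, KState.handshake, KState.prepare, hs]
        · simp [h3, KState.handshake, KState.prepare, hs, KState.refresh]
        · intro ℓ
          rw [hb, hv]
          simp only [h3, KState.handshake, KState.prepare, hs, Bool.true_eq_false, if_false, hr]
          split_ifs with h h' <;> simp [*]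
    · refine Or.inr (Or.inr (Or.inr ⟨hu, hg, ?_, ?_, ?_, ?_, ?_⟩))
      · simp [h3, KState.execute]
      · simp [h3, KState.execute]
      · simp [h3, KState.execute]
      · simpa [h3, KState.execute] using hy
      · intro ℓ
        simp [h3, KState.execute]
  · obtain rfl := h2 hu
    refine Or.inl ⟨hu, ?_, ?_, ?_, ?_, ?_, ?_, ?_, ?_, ?_⟩ <;> simp [h3]
    intro ℓ
    tauto

end SemiExecution

/-! ### Evolution of valid ports, stored data and phases -/

namespace SemiExecution

variable {V : Type*} {Δ : ℕ} {Main Port Act : Type*} {A : SyncAlgorithm Δ Main Port Act}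
  {x₀ : V → AlgState Δ Main Port} {e : SemiExecution A x₀} {t : ℕ} {u v : V} {ℓ m : Fin Δ}

theorem Idle.mem_valid (h : e.Idle t u) : ℓ ∈ (e.cfg (t + 1) u).valid ↔
    ℓ ∈ (e.cfg t u).valid ∧ ℓ ∉ (e.net t).lost (e.net (t + 1)) u := by
  simp only [KState.valid, h.P, h.Dt, h.D, Set.mem_sdiff, Set.mem_union]
  tauto

theorem Refreshes.mem_valid (h : e.Refreshes t u) : ℓ ∈ (e.cfg (t + 1) u).valid ↔
    ℓ ∈ (e.cfg t u).valid ∧ ℓ ∉ (e.net t).lost (e.net (t + 1)) u := by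
  simp only [KState.valid, h.P, h.Dt, h.D, Set.mem_sdiff, Set.mem_union]
  tauto

theorem Starts.mem_valid (h : e.Starts t u) : ℓ ∈ (e.cfg (t + 1) u).valid ↔
    ℓ ∈ (e.cfg (t + 1) u).P ∧ ℓ ∉ (e.net t).lost (e.net (t + 1)) u := by
  simp only [KState.valid, h.Dt, h.D, Set.mem_sdiff, Set.mem_union, Set.mem_empty_iff_false]
  tauto

/-- The complement of `invalid` in terms of `valid`: a neighbour already in the phase must itself
accept the edge, which is what `Compatible` asks for. -/
theorem Starts.mem_P (h : e.Starts t u) (hl : (e.net t).link u ℓ = some (v, m)) :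
    ℓ ∈ (e.cfg (t + 1) u).P ↔ (e.cfg t v).phase ≤ (e.cfg t u).phase ∧
      ((e.cfg t v).phase = (e.cfg t u).phase → (e.cfg t v).synch = true →
        m ∈ (e.cfg t v).valid) := by
  simp only [h.P, KState.invalid, kPull, Set.mem_sdiff, Set.mem_ofPred_eq, hl, Option.map_some,
    Option.some.injEq, KState.valid]
  constructor
  · rintro ⟨-, h2⟩
    refine ⟨?_, fun h3 h4 => ?_⟩
    · by_contra h3
      exact h2 ⟨_, rfl, Or.inr (not_le.mp h3)⟩
    · by_contra h5
      refine h2 ⟨_, rfl, Or.inl ⟨h3, h4, ?_⟩⟩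
      simpa only [KState.expose, not_and_or, not_not] using h5
  · rintro ⟨h1, h2⟩
    refine ⟨by simp, ?_⟩
    rintro ⟨x, rfl, ⟨h3, h4, h5⟩ | h3⟩
    · have := h2 h3 h4
      simp only [KState.expose] at h5
      tauto
    · exact absurd h3 (not_lt.mpr h1)

theorem Starts.X_eq (h : e.Starts t u) (hl : (e.net t).link u ℓ = some (v, m)) :
    (e.cfg (t + 1) u).X ℓ = some ((e.cfg t v).expose m) := by
  simp [h.X, hl]

theorem Starts.exists_link (h : e.Starts t u) (hP : ℓ ∈ (e.cfg (t + 1) u).P) :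
    ∃ v m, (e.net t).link u ℓ = some (v, m) := by
  rw [h.P] at hP
  obtain ⟨⟨v, m⟩, hq⟩ := Option.ne_none_iff_exists'.mp hP.1
  exact ⟨v, m, hq⟩

theorem Refreshes.X_eq_fresh (h : e.Refreshes t u) (hv : ℓ ∈ (e.cfg t u).valid)
    (hl : (e.net t).link u ℓ = some (v, m)) {x : Pulled Δ Main Port}
    (hx : (e.cfg t u).X ℓ = some x) (hp : x.phase < (e.cfg t u).phase) :
    (e.cfg (t + 1) u).X ℓ = some ((e.cfg t v).expose m) := by
  rw [h.X]
  simp only [KState.refresh]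
  rw [if_pos (show ℓ ∈ _ \ (_ ∪ _) from hv)]
  simp [hx, kPull, hl, hp]

theorem Refreshes.X_eq_ack (h : e.Refreshes t u) (hv : ℓ ∈ (e.cfg t u).valid)
    (hl : (e.net t).link u ℓ = some (v, m)) {x : Pulled Δ Main Port}
    (hx : (e.cfg t u).X ℓ = some x) (hp : ¬ x.phase < (e.cfg t u).phase) :
    (e.cfg (t + 1) u).X ℓ = some { x with ack := (e.cfg t v).ack m } := by
  rw [h.X]
  simp only [KState.refresh]
  rw [if_pos (show ℓ ∈ _ \ (_ ∪ _) from hv)]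
  simp [hx, kPull, hl, hp, KState.expose]

theorem Refreshes.X_eq_of_not_valid (h : e.Refreshes t u) (hv : ℓ ∉ (e.cfg t u).valid) :
    (e.cfg (t + 1) u).X ℓ = (e.cfg t u).X ℓ := by
  rw [h.X]
  simp only [KState.refresh]
  rw [if_neg (show ℓ ∉ _ \ (_ ∪ _) from hv)]

theorem link_succ (hl : (e.net t).link u ℓ = some (v, m))
    (h : ℓ ∉ (e.net t).lost (e.net (t + 1)) u) : (e.net (t + 1)).link u ℓ = some (v, m) := by
  by_contra h'
  exact h ⟨by simp [hl], by rwa [hl]⟩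

theorem not_mem_lost (hl : (e.net t).link u ℓ = some (v, m))
    (h : ℓ ∉ (e.net t).lost (e.net (t + 1)) u) : m ∉ (e.net t).lost (e.net (t + 1)) v := by
  intro h'
  refine h'.2 ?_
  rw [(e.net t).symm _ _ _ _ hl, (e.net (t + 1)).symm _ _ _ _ (link_succ hl h)]

theorem phase_succ (e : SemiExecution A x₀) (t : ℕ) (u : V) :
    (e.cfg (t + 1) u).phase = (e.cfg t u).phase ∨
      ((e.cfg (t + 1) u).phase = (e.cfg t u).phase + 1 ∧ e.Executes t u) := by
  rcases e.stage_cases t u with h | h | h | h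
  · exact Or.inl h.phase
  · exact Or.inl h.phase
  · exact Or.inl h.phase
  · exact Or.inr ⟨h.phase, h⟩

theorem phase_le_succ (e : SemiExecution A x₀) (t : ℕ) (u : V) :
    (e.cfg t u).phase ≤ (e.cfg (t + 1) u).phase := by
  rcases e.phase_succ t u with h | h <;> omega

theorem phase_mono (e : SemiExecution A x₀) (u : V) : Monotone fun t => (e.cfg t u).phase :=
  monotone_nat_of_le_succ fun t => e.phase_le_succ t u

/-! ### The invariant, and preservation of its clauses about a single node -/

/-- The invariant of the executions of the synchronizer. -/
structure Consistent (e : SemiExecution A x₀) (t : ℕ) : Prop where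
  clean : ∀ u ℓ, (e.cfg t u).synch = false →
    (e.cfg t u).ack ℓ = false ∧ (e.cfg t u).block ℓ = false
  pulled : ∀ u, (e.cfg t u).synch = true → ∀ ℓ ∈ (e.cfg t u).P,
    ∃ x, (e.cfg t u).X ℓ = some x ∧ x.phase ≤ (e.cfg t u).phase
  ack : ∀ u ℓ, (e.cfg t u).ack ℓ = true → ℓ ∈ (e.cfg t u).P ∧
    ∃ x, (e.cfg t u).X ℓ = some x ∧ x.phase = (e.cfg t u).phase
  block : ∀ u ℓ, (e.cfg t u).block ℓ = true → ℓ ∈ (e.cfg t u).P ∧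
    ∃ x, (e.cfg t u).X ℓ = some x ∧ x.phase = (e.cfg t u).phase
  edge : ∀ u ℓ, (e.cfg t u).synch = true → ℓ ∈ (e.cfg t u).valid →
    ∃ v m, (e.net t).link u ℓ = some (v, m) ∧
      (∀ x, (e.cfg t u).X ℓ = some x → x.phase ≤ (e.cfg t v).phase) ∧
      (e.cfg t u).Compatible ℓ (e.cfg t v) m

namespace Consistent

theorem synch_of_ack (h : e.Consistent t) (ha : (e.cfg t u).ack ℓ = true) :
    (e.cfg t u).synch = true := by
  by_contra hs
  have := (h.clean u ℓ (by simpa using hs)).1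
  simp [ha] at this

theorem edge_of_link (h : e.Consistent t) (hl : (e.net t).link u ℓ = some (v, m))
    (hs : (e.cfg t u).synch = true) (hv : ℓ ∈ (e.cfg t u).valid) :
    (∀ x, (e.cfg t u).X ℓ = some x → x.phase ≤ (e.cfg t v).phase) ∧
      (e.cfg t u).Compatible ℓ (e.cfg t v) m := by
  obtain ⟨v', m', hl', h1⟩ := h.edge u ℓ hs hv
  rw [hl] at hl'
  obtain ⟨rfl, rfl⟩ : v = v' ∧ m = m' := by simpa using hl'
  exact h1

/-- A raised `ack` flag is read in the current stage, and such a flag means that its owner has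
started its phase. The edge relation then shows that this is the same phase and that the edge is
valid at both ends. -/
theorem blocks_spec (h : e.Consistent t) (hl : (e.net t).link v m = some (u, ℓ))
    (hb : e.Blocks t v m) : (e.cfg t u).phase = (e.cfg t v).phase ∧ (e.cfg t u).synch = true ∧
      ℓ ∈ (e.cfg t u).valid ∧ (e.cfg t u).block ℓ = false ∧ (e.cfg t u).ack ℓ = true ∧
      (e.cfg t v).block m = false := by
  have hl' := (e.net t).symm _ _ _ _ hl
  rcases e.stage_cases t v with hv | hv | hv | hv
  · exact absurd hb.1 hv.inactive
  · obtain ⟨⟨hP, -⟩, hf, x, hx, hxp, hxa⟩ := (hv.blocks m).1 hb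
    rw [hv.X_eq hl] at hx
    obtain rfl : (e.cfg t u).expose ℓ = x := by simpa using hx
    simp only [KState.expose] at hxp hxa
    have hs := h.synch_of_ack hxa
    have hval := ((hv.mem_P hl).1 hP).2 hxp hs
    refine ⟨hxp, hs, hval, ?_, hxa, hf⟩
    have hv0 := hv.synch₀
    -- Seen from `u`, the neighbour `v` has not started; the cases compatible with this have port
    -- `ℓ` unblocked.
    rcases (h.edge_of_link hl' hs hval).2 with h1 | h1 | h1 | h1
    · exact h1.2
    · exact h1.2.2
    · simp [h1.2.1] at hv0
    · omega
  · obtain ⟨⟨hP, hDt⟩, hf, x, hx, hxp, hxa⟩ := (hv.blocks m).1 hb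
    have hval : m ∈ (e.cfg t v).valid := by
      rw [hv.P] at hP
      rw [hv.Dt] at hDt
      exact ⟨hP, hDt⟩
    have hp : (e.cfg t u).phase = (e.cfg t v).phase ∧ (e.cfg t u).ack ℓ = true := by
      obtain ⟨y, hy, hyp⟩ := h.pulled v hv.synch₀ m hval.1
      by_cases hlt : y.phase < (e.cfg t v).phase
      · rw [hv.X_eq_fresh hval hl hy hlt] at hx
        obtain rfl : (e.cfg t u).expose ℓ = x := by simpa using hx
        exact ⟨hxp, hxa⟩
      · rw [hv.X_eq_ack hval hl hy hlt] at hx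
        obtain rfl := Option.some.inj hx
        refine ⟨?_, hxa⟩
        -- Only `ack` is fresh here. The stored phase is that of `v` and bounds the phase of `u`
        -- from below; if `u` were ahead, port `m` would be blocked.
        obtain ⟨h1, h2⟩ := h.edge_of_link hl hv.synch₀ hval
        have := h1 y hy
        rcases h2 with h1 | h1 | h1 | h1
        · omega
        · exact h1.1
        · exact h1.1
        · simp [h1.2.1] at hf
    have hs := h.synch_of_ack hp.2
    rcases (h.edge_of_link hl hv.synch₀ hval).2 with h1 | h1 | h1 | h1
    · omega
    · simp [h1.2.1] at hs
    · exact ⟨hp.1, hs, h1.2.2.1, h1.2.2.2 ▸ hf, hp.2, hf⟩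
    · omega
  · exact absurd hv.guard (KState.not_executeGuard_of_handshakeGuard hb.2.1)

theorem blockedByNeighbor_spec (h : e.Consistent t)
    (hb : BlockedByNeighbor (e.net t) (e.active t) (e.cfg t) u ℓ) :
    (e.cfg t u).synch = true ∧ ℓ ∈ (e.cfg t u).valid ∧ (e.cfg t u).block ℓ = false ∧
      (e.cfg t u).ack ℓ = true ∧ ∃ v m, (e.net t).link u ℓ = some (v, m) ∧
        (e.cfg t v).phase = (e.cfg t u).phase ∧ e.Blocks t v m := by
  obtain ⟨v, m, hl, hb⟩ := exists_blocks_of_blockedByNeighbor e hb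
  obtain ⟨h1, h2, h3, h4, h5, -⟩ := h.blocks_spec ((e.net t).symm _ _ _ _ hl) hb
  exact ⟨h2, h3, h4, h5, v, m, hl, h1.symm, hb⟩

/-- BLOCK arrives only at valid unblocked ports, and an executing node has none. Hence no flag leaks
into the next phase. -/
theorem executes_block (h : e.Consistent t) (hu : e.Executes t u) (ℓ : Fin Δ) :
    (e.cfg (t + 1) u).block ℓ = false := by
  by_contra hb
  obtain ⟨h1, h2, h3, -⟩ := h.blockedByNeighbor_spec ((hu.block ℓ).1 (by simpa using hb))
  have := hu.guard.2 ℓ ⟨h2.1, fun h4 => h2.2 (Or.inl h4)⟩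
  simp [h3] at this

/-- The data stored at a valid port after HANDSHAKE are the old ones up to `ack`, unless these
stem from an earlier phase. -/
theorem refreshes_X (h : e.Consistent t) (hu : e.Refreshes t u)
    {x : Pulled Δ Main Port} (hx : (e.cfg t u).X ℓ = some x) (hp : x.phase = (e.cfg t u).phase) :
    ∃ y, (e.cfg (t + 1) u).X ℓ = some y ∧ y.phase = x.phase ∧ y.algMain = x.algMain ∧
      y.algPort = x.algPort := by
  by_cases hv : ℓ ∈ (e.cfg t u).valid
  · obtain ⟨v, m, hl, -⟩ := h.edge u ℓ hu.synch₀ hv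
    rw [hu.X_eq_ack hv hl hx (by omega)]
    exact ⟨_, rfl, rfl, rfl, rfl⟩
  · rw [hu.X_eq_of_not_valid hv]
    exact ⟨x, hx, rfl, rfl, rfl⟩

theorem clean_succ (h : e.Consistent t) (u : V) (ℓ : Fin Δ)
    (hs : (e.cfg (t + 1) u).synch = false) :
    (e.cfg (t + 1) u).ack ℓ = false ∧ (e.cfg (t + 1) u).block ℓ = false := by
  rcases e.stage_cases t u with hu | hu | hu | hu
  · rw [hu.synch] at hs
    obtain ⟨h1, h2⟩ := h.clean u ℓ hs
    refine ⟨by rw [hu.ack, h1], ?_⟩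
    by_contra hb
    rcases (hu.block ℓ).1 (by simpa using hb) with hb | hb
    · simp [h2] at hb
    · have := (h.blockedByNeighbor_spec hb).1
      simp [hs] at this
  · simp [hu.synch] at hs
  · simp [hu.synch] at hs
  · exact ⟨hu.ack ℓ, h.executes_block hu ℓ⟩

theorem pulled_succ (h : e.Consistent t) (u : V) (hs : (e.cfg (t + 1) u).synch = true)
    (ℓ : Fin Δ) (hP : ℓ ∈ (e.cfg (t + 1) u).P) :
    ∃ x, (e.cfg (t + 1) u).X ℓ = some x ∧ x.phase ≤ (e.cfg (t + 1) u).phase := by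
  rcases e.stage_cases t u with hu | hu | hu | hu
  · rw [hu.synch] at hs
    rw [hu.P] at hP
    rw [hu.X, hu.phase]
    exact h.pulled u hs ℓ hP
  · obtain ⟨v, m, hl⟩ := hu.exists_link hP
    rw [hu.X_eq hl, hu.phase]
    exact ⟨_, rfl, ((hu.mem_P hl).1 hP).1⟩
  · rw [hu.P] at hP
    rw [hu.phase]
    obtain ⟨x, hx, hxp⟩ := h.pulled u hu.synch₀ ℓ hP
    by_cases hv : ℓ ∈ (e.cfg t u).valid
    · obtain ⟨v, m, hl, h1, h2⟩ := h.edge u ℓ hu.synch₀ hv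
      by_cases hlt : x.phase < (e.cfg t u).phase
      · rw [hu.X_eq_fresh hv hl hx hlt]
        refine ⟨_, rfl, ?_⟩
        simp only [KState.expose]
        rcases h2 with h2 | h2 | h2 | h2
        · omega
        · omega
        · omega
        · obtain ⟨-, y, hy, hyp⟩ := h.block u ℓ h2.2.1
          rw [hx] at hy
          obtain rfl := Option.some.inj hy
          omega
      · rw [hu.X_eq_ack hv hl hx hlt]
        exact ⟨_, rfl, hxp⟩
    · rw [hu.X_eq_of_not_valid hv]
      exact ⟨x, hx, hxp⟩
  · simp [hu.synch] at hs

theorem visits_spec {a : Bool} (h : e.Visits t u ℓ a)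
    (hp : (e.cfg (t + 1) u).phase = (e.cfg t u).phase) :
    ℓ ∈ (e.cfg (t + 1) u).P ∧
      ∃ x, (e.cfg (t + 1) u).X ℓ = some x ∧ x.phase = (e.cfg (t + 1) u).phase := by
  obtain ⟨h1, -, x, hx, hxp, -⟩ := h
  exact ⟨h1.1, x, hx, by omega⟩

theorem refreshes_stored (h : e.Consistent t) (hu : e.Refreshes t u)
    (h1 : ℓ ∈ (e.cfg t u).P ∧ ∃ x, (e.cfg t u).X ℓ = some x ∧ x.phase = (e.cfg t u).phase) :
    ℓ ∈ (e.cfg (t + 1) u).P ∧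
      ∃ x, (e.cfg (t + 1) u).X ℓ = some x ∧ x.phase = (e.cfg (t + 1) u).phase := by
  obtain ⟨hP, x, hx, hxp⟩ := h1
  obtain ⟨y, hy, hyp, -⟩ := h.refreshes_X hu hx hxp
  exact ⟨by rwa [hu.P], y, hy, by rw [hu.phase]; omega⟩

theorem ack_succ (h : e.Consistent t) (u : V) (ℓ : Fin Δ)
    (ha : (e.cfg (t + 1) u).ack ℓ = true) : ℓ ∈ (e.cfg (t + 1) u).P ∧
      ∃ x, (e.cfg (t + 1) u).X ℓ = some x ∧ x.phase = (e.cfg (t + 1) u).phase := by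
  rcases e.stage_cases t u with hu | hu | hu | hu
  · rw [hu.ack] at ha
    rw [hu.P, hu.X, hu.phase]
    exact h.ack u ℓ ha
  · rcases (hu.ack ℓ).1 ha with ha | ha
    · simp [(h.clean u ℓ hu.synch₀).1] at ha
    · exact visits_spec ha hu.phase
  · rcases (hu.ack ℓ).1 ha with ha | ha
    · exact h.refreshes_stored hu (h.ack u ℓ ha)
    · exact visits_spec ha hu.phase
  · simp [hu.ack] at ha

/-- A port may be blocked by the neighbour alone. That it holds data of the current phase then
follows from its own `ack` flag, which the neighbour has read. -/
theorem block_succ (h : e.Consistent t) (u : V) (ℓ : Fin Δ)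
    (hb : (e.cfg (t + 1) u).block ℓ = true) : ℓ ∈ (e.cfg (t + 1) u).P ∧
      ∃ x, (e.cfg (t + 1) u).X ℓ = some x ∧ x.phase = (e.cfg (t + 1) u).phase := by
  rcases e.stage_cases t u with hu | hu | hu | hu
  · rw [hu.P, hu.X, hu.phase]
    rcases (hu.block ℓ).1 hb with hb | hb
    · exact h.block u ℓ hb
    · exact h.ack u ℓ (h.blockedByNeighbor_spec hb).2.2.2.1
  · rcases (hu.block ℓ).1 hb with hb | hb | hb
    · simp [(h.clean u ℓ hu.synch₀).2] at hb
    · exact visits_spec ((hu.blocks ℓ).1 hb) hu.phase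
    · have := (h.blockedByNeighbor_spec hb).1
      simp [hu.synch₀] at this
  · rcases (hu.block ℓ).1 hb with hb | hb | hb
    · exact h.refreshes_stored hu (h.block u ℓ hb)
    · exact visits_spec ((hu.blocks ℓ).1 hb) hu.phase
    · exact h.refreshes_stored hu (h.ack u ℓ (h.blockedByNeighbor_spec hb).2.2.2.1)
  · simp [h.executes_block hu] at hb

end Consistent

/-- The node continues a phase that it has started earlier. -/
structure Continues (e : SemiExecution A x₀) (t : ℕ) (u : V) : Prop where
  synch₀ : (e.cfg t u).synch = true
  synch : (e.cfg (t + 1) u).synch = true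
  phase : (e.cfg (t + 1) u).phase = (e.cfg t u).phase
  alg : (e.cfg (t + 1) u).alg = (e.cfg t u).alg
  P : (e.cfg (t + 1) u).P = (e.cfg t u).P
  mem_valid : ∀ ℓ, ℓ ∈ (e.cfg (t + 1) u).valid ↔
    ℓ ∈ (e.cfg t u).valid ∧ ℓ ∉ (e.net t).lost (e.net (t + 1)) u
  block : ∀ ℓ, (e.cfg (t + 1) u).block ℓ = true ↔ (e.cfg t u).block ℓ = true ∨
    e.Blocks t u ℓ ∨ BlockedByNeighbor (e.net t) (e.active t) (e.cfg t) u ℓ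

/-- The node stays inactive between two phases. -/
structure Waits (e : SemiExecution A x₀) (t : ℕ) (u : V) : Prop where
  inactive : u ∉ e.active t
  synch₀ : (e.cfg t u).synch = false
  synch : (e.cfg (t + 1) u).synch = false
  phase : (e.cfg (t + 1) u).phase = (e.cfg t u).phase
  alg : (e.cfg (t + 1) u).alg = (e.cfg t u).alg

theorem Idle.not_blocks (h : e.Idle t u) : ¬ e.Blocks t u ℓ := fun hb => h.inactive hb.1

theorem Refreshes.continues (h : e.Refreshes t u) : e.Continues t u :=
  ⟨h.synch₀, h.synch, h.phase, h.alg, h.P, fun _ => h.mem_valid, h.block⟩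

theorem Idle.continues (h : e.Idle t u) (hs : (e.cfg t u).synch = true) : e.Continues t u :=
  ⟨hs, h.synch.trans hs, h.phase, h.alg, h.P, fun _ => h.mem_valid, fun ℓ => by
    simp [h.block, h.not_blocks]⟩

theorem Idle.waits (h : e.Idle t u) (hs : (e.cfg t u).synch = false) : e.Waits t u :=
  ⟨h.inactive, hs, h.synch.trans hs, h.phase, h.alg⟩

/-- Within a phase, idling and refreshing affect the edge relation alike, so they are merged. -/
theorem stage_cases' (e : SemiExecution A x₀) (t : ℕ) (u : V) :
    e.Waits t u ∨ e.Starts t u ∨ e.Continues t u ∨ e.Executes t u := by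
  rcases e.stage_cases t u with hu | hu | hu | hu
  · cases hs : (e.cfg t u).synch
    · exact Or.inl (hu.waits hs)
    · exact Or.inr (Or.inr (Or.inl (hu.continues hs)))
  · exact Or.inr (Or.inl hu)
  · exact Or.inr (Or.inr (Or.inl hu.continues))
  · exact Or.inr (Or.inr (Or.inr hu))

end SemiExecution

/-! ### Preservation of the edge relation -/

namespace SemiExecution

variable {V : Type*} {Δ : ℕ} {Main Port Act : Type*} {A : SyncAlgorithm Δ Main Port Act}
  {x₀ : V → AlgState Δ Main Port} {e : SemiExecution A x₀} {t : ℕ} {u v : V} {ℓ m : Fin Δ}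

theorem Waits.not_blocks (h : e.Waits t u) : ¬ e.Blocks t u ℓ := fun hb => h.inactive hb.1

theorem Executes.not_blocks (h : e.Executes t u) : ¬ e.Blocks t u ℓ := fun hb =>
  KState.not_executeGuard_of_handshakeGuard hb.2.1 h.guard

theorem Executes.block_of_valid (h : e.Executes t u) (hv : ℓ ∈ (e.cfg t u).valid) :
    (e.cfg t u).block ℓ = true :=
  h.guard.2 ℓ ⟨hv.1, fun h4 => hv.2 (Or.inl h4)⟩

namespace Consistent

theorem stored_le_succ (h : e.Consistent t) (hl : (e.net t).link u ℓ = some (v, m))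
    (hs : (e.cfg (t + 1) u).synch = true) (hv : ℓ ∈ (e.cfg (t + 1) u).valid)
    {x : Pulled Δ Main Port} (hx : (e.cfg (t + 1) u).X ℓ = some x) :
    x.phase ≤ (e.cfg (t + 1) v).phase := by
  refine le_trans ?_ (e.phase_le_succ t v)
  rcases e.stage_cases t u with hu | hu | hu | hu
  · rw [hu.synch] at hs
    rw [hu.mem_valid] at hv
    rw [hu.X] at hx
    exact (h.edge_of_link hl hs hv.1).1 x hx
  · rw [hu.X_eq hl] at hx
    obtain rfl := Option.some.inj hx
    exact le_rfl
  · rw [hu.mem_valid] at hv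
    obtain ⟨y, hy, -⟩ := h.pulled u hu.synch₀ ℓ hv.1.1
    by_cases hlt : y.phase < (e.cfg t u).phase
    · rw [hu.X_eq_fresh hv.1 hl hy hlt] at hx
      obtain rfl := Option.some.inj hx
      exact le_rfl
    · rw [hu.X_eq_ack hv.1 hl hy hlt] at hx
      obtain rfl := Option.some.inj hx
      exact (h.edge_of_link hl hu.synch₀ hv.1).1 y hy
  · simp [hu.synch] at hs

/-- BLOCK crosses the edge only between ends that have started the same phase, and then it reaches
both flags at once. A neighbour that starts now keeps the edge because `ℓ` is valid at `u`; one that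
executes now had its port blocked, hence also port `ℓ`. -/
theorem compatible_succ_of_continues (h : e.Consistent t) (hu : e.Continues t u)
    (hl : (e.net t).link u ℓ = some (v, m)) (hv : ℓ ∈ (e.cfg t u).valid)
    (hlost : m ∉ (e.net t).lost (e.net (t + 1)) v) :
    (e.cfg (t + 1) u).Compatible ℓ (e.cfg (t + 1) v) m := by
  have hl' := (e.net t).symm _ _ _ _ hl
  have hub := fun hb => h.blocks_spec hl (u := v) (v := u) hb
  have hvb := fun hb => h.blocks_spec hl' (u := u) (v := v) hb
  have hbu := hu.block ℓ
  rw [blockedByNeighbor_iff e hl] at hbu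
  have hbv := blockedByNeighbor_iff e hl'
  have hus := hu.synch₀
  unfold KState.Compatible
  rw [hu.phase]
  rcases (h.edge_of_link hl hu.synch₀ hv).2 with ⟨h1, h2⟩ | ⟨h1, h2, h3⟩ | ⟨h1, h2, h3, h4⟩ |
      ⟨h1, h2, h3⟩
  · have hb : (e.cfg (t + 1) u).block ℓ = false := by
      rw [← Bool.not_eq_true, hbu]
      rintro (hb | hb | hb)
      · simp [h2] at hb
      · have := (hub hb).1
        omega
      · have := (hvb hb).1
        omega
    rcases e.phase_succ t v with hp | ⟨hp, hve⟩
    · exact Or.inl ⟨by omega, hb⟩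
    · by_cases hlt : (e.cfg (t + 1) v).phase < (e.cfg t u).phase
      · exact Or.inl ⟨hlt, hb⟩
      · exact Or.inr (Or.inl ⟨by omega, hve.synch, hb⟩)
  · have hnb : ¬ e.Blocks t u ℓ := fun hb => by simp [(hub hb).2.1] at h2
    simp only [h3, Bool.false_eq_true, hnb, false_or] at hbu
    rcases e.stage_cases' t v with hv' | hv' | hv' | hv'
    · refine Or.inr (Or.inl ⟨by rw [hv'.phase, h1], hv'.synch, ?_⟩)
      rw [← Bool.not_eq_true, hbu]
      exact hv'.not_blocks
    · refine Or.inr (Or.inr (Or.inl ⟨by rw [hv'.phase, h1], hv'.synch, ?_, ?_⟩))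
      · rw [hv'.mem_valid, hv'.mem_P hl']
        exact ⟨⟨h1.ge, fun _ _ => hv⟩, hlost⟩
      · rw [Bool.eq_iff_iff, hbu, hv'.block, hbv]
        simp [(h.clean v m h2).2, hnb]
    · simp [hv'.synch₀] at h2
    · simp [hv'.guard.1] at h2
  · rcases e.stage_cases' t v with hv' | hv' | hv' | hv'
    · simp [hv'.synch₀] at h2
    · simp [hv'.synch₀] at h2
    · refine Or.inr (Or.inr (Or.inl ⟨by rw [hv'.phase, h1], hv'.synch, ?_, ?_⟩))
      · rw [hv'.mem_valid]
        exact ⟨h3, hlost⟩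
      · rw [Bool.eq_iff_iff, hbu, hv'.block, hbv, h4]
        tauto
    · refine Or.inr (Or.inr (Or.inr ⟨by rw [hv'.phase, h1], ?_, Or.inl hv'.synch⟩))
      rw [hbu, h4]
      exact Or.inl (hv'.block_of_valid h3)
  · refine Or.inr (Or.inr (Or.inr ⟨?_, hbu.2 (Or.inl h2), ?_⟩))
    · rcases e.phase_succ t v with hp | ⟨hp, hve⟩
      · omega
      -- A neighbour one phase ahead cannot advance: its port would be blocked and so hold data of
      -- its own phase, which `u` has not reached.
      · exfalso
        rcases h3 with h3 | h3
        · simp [hve.guard.1] at h3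
        · obtain ⟨-, x, hx, hxp⟩ := h.block v m (hve.block_of_valid h3)
          have := (h.edge_of_link hl' hve.guard.1 h3).1 x hx
          omega
    · rcases e.stage_cases' t v with hv' | hv' | hv' | hv'
      · exact Or.inl hv'.synch
      · refine Or.inr ?_
        rw [hv'.mem_valid, hv'.mem_P hl']
        exact ⟨⟨by omega, fun _ _ => hv⟩, hlost⟩
      · refine Or.inr ?_
        rw [hv'.mem_valid]
        rcases h3 with h3 | h3
        · simp [hv'.synch₀] at h3
        · exact ⟨h3, hlost⟩
      · exact Or.inl hv'.synch

/-- The relation is read from the end of `v`. As `u` has not started, a valid port `m` of a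
neighbour in the same phase is unblocked, so that neighbour cannot leave the phase in this stage. -/
theorem compatible_succ_of_starts (h : e.Consistent t) (hu : e.Starts t u)
    (hl : (e.net t).link u ℓ = some (v, m)) (hP : ℓ ∈ (e.cfg (t + 1) u).P)
    (hlost : m ∉ (e.net t).lost (e.net (t + 1)) v) :
    (e.cfg (t + 1) u).Compatible ℓ (e.cfg (t + 1) v) m := by
  have hl' := (e.net t).symm _ _ _ _ hl
  have hub := fun hb => h.blocks_spec hl (u := v) (v := u) hb
  have hvb : ¬ e.Blocks t v m := fun hb => by
    have := (h.blocks_spec hl' hb).2.1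
    simp [hu.synch₀] at this
  have hbu := hu.block ℓ
  rw [blockedByNeighbor_iff e hl] at hbu
  simp only [(h.clean u ℓ hu.synch₀).2, hvb, Bool.false_eq_true, false_or, or_false] at hbu
  have hbv := blockedByNeighbor_iff e hl'
  obtain ⟨hp1, hp2⟩ := (hu.mem_P hl).1 hP
  unfold KState.Compatible
  rw [hu.phase]
  by_cases hlt : (e.cfg t v).phase < (e.cfg t u).phase
  · have hb : (e.cfg (t + 1) u).block ℓ = false := by
      rw [← Bool.not_eq_true, hbu]
      intro hb
      have := (hub hb).1
      omega
    rcases e.phase_succ t v with hp | ⟨hp, hve⟩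
    · exact Or.inl ⟨by omega, hb⟩
    · by_cases hlt : (e.cfg (t + 1) v).phase < (e.cfg t u).phase
      · exact Or.inl ⟨hlt, hb⟩
      · exact Or.inr (Or.inl ⟨by omega, hve.synch, hb⟩)
  · have hp : (e.cfg t v).phase = (e.cfg t u).phase := by omega
    have hmv : ∀ (hs : (e.cfg t v).synch = true), (e.cfg t v).block m = false := fun hs => by
      rcases (h.edge_of_link hl' hs (hp2 hp hs)).2 with h1 | h1 | h1 | h1
      · exact h1.2
      · exact h1.2.2
      · simp [hu.synch₀] at h1
      · omega
    rcases e.stage_cases' t v with hv' | hv' | hv' | hv'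
    · refine Or.inr (Or.inl ⟨by rw [hv'.phase, hp], hv'.synch, ?_⟩)
      rw [← Bool.not_eq_true, hbu]
      intro hb
      have := (hub hb).2.1
      simp [hv'.synch₀] at this
    -- Both ends start together. Reads precede writes, so each sees the other as not yet started and
    -- keeps the edge.
    · refine Or.inr (Or.inr (Or.inl ⟨by rw [hv'.phase, hp], hv'.synch, ?_, ?_⟩))
      · rw [hv'.mem_valid, hv'.mem_P hl']
        exact ⟨⟨hp.ge, fun _ hs => by simp [hu.synch₀] at hs⟩, hlost⟩
      · rw [Bool.eq_iff_iff, hbu, hv'.block, hbv]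
        simp [(h.clean v m hv'.synch₀).2, hvb]
    · refine Or.inr (Or.inr (Or.inl ⟨by rw [hv'.phase, hp], hv'.synch, ?_, ?_⟩))
      · rw [hv'.mem_valid]
        exact ⟨hp2 hp hv'.synch₀, hlost⟩
      · rw [Bool.eq_iff_iff, hbu, hv'.block, hbv, hmv hv'.synch₀]
        simp [hvb]
    · have := hmv hv'.guard.1
      simp [hv'.block_of_valid (hp2 hp hv'.guard.1)] at this

theorem edge_succ (h : e.Consistent t) (u : V) (ℓ : Fin Δ)
    (hs : (e.cfg (t + 1) u).synch = true) (hv : ℓ ∈ (e.cfg (t + 1) u).valid) :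
    ∃ v m, (e.net (t + 1)).link u ℓ = some (v, m) ∧
      (∀ x, (e.cfg (t + 1) u).X ℓ = some x → x.phase ≤ (e.cfg (t + 1) v).phase) ∧
      (e.cfg (t + 1) u).Compatible ℓ (e.cfg (t + 1) v) m := by
  rcases e.stage_cases' t u with hu | hu | hu | hu
  · simp [hu.synch] at hs
  · obtain ⟨hP, hlost⟩ := hu.mem_valid.1 hv
    obtain ⟨v, m, hl⟩ := hu.exists_link hP
    exact ⟨v, m, link_succ hl hlost, fun x hx => h.stored_le_succ hl hs hv hx,
      h.compatible_succ_of_starts hu hl hP (not_mem_lost hl hlost)⟩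
  · obtain ⟨hv', hlost⟩ := (hu.mem_valid ℓ).1 hv
    obtain ⟨v, m, hl, -⟩ := h.edge u ℓ hu.synch₀ hv'
    exact ⟨v, m, link_succ hl hlost, fun x hx => h.stored_le_succ hl hs hv hx,
      h.compatible_succ_of_continues hu hl hv' (not_mem_lost hl hlost)⟩
  · simp [hu.synch] at hs

end Consistent

theorem consistent (e : SemiExecution A x₀) (t : ℕ) : e.Consistent t := by
  induction t with
  | zero => constructor <;> simp [e.init, KState.initial]
  | succ t ih => exact ⟨ih.clean_succ, ih.pulled_succ, ih.ack_succ, ih.block_succ, ih.edge_succ⟩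

/-! ### Progress -/

theorem exists_active (hf : e.WeaklyFair) (t : ℕ) (u : V) : ∃ t', t ≤ t' ∧ u ∈ e.active t' :=
  hf u t fun _ _ => KState.handshakeGuard_or_executeGuard _

theorem continues_or_of_phase_eq {r : ℕ} (hp : ∀ t, r ≤ t → (e.cfg t u).phase = (e.cfg r u).phase)
    (hs : (e.cfg r u).synch = true) : ∀ t, r ≤ t → (e.cfg t u).synch = true ∧ e.Continues t u := by
  have key : ∀ t, r ≤ t → (e.cfg t u).synch = true → e.Continues t u := by
    intro t ht hs
    rcases e.stage_cases' t u with hu | hu | hu | hu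
    · simp [hu.synch₀] at hs
    · simp [hu.synch₀] at hs
    · exact hu
    · have := hu.phase
      rw [hp t ht, hp (t + 1) (by omega)] at this
      omega
  intro t ht
  induction t, ht using Nat.le_induction with
  | base => exact ⟨hs, key r le_rfl hs⟩
  | succ t ht ih => exact ⟨ih.2.synch, key (t + 1) (by omega) ih.2.synch⟩

theorem eventually_synch (hf : e.WeaklyFair) {r : ℕ}
    (hp : ∀ t, r ≤ t → (e.cfg t u).phase = (e.cfg r u).phase) :
    ∃ r', r ≤ r' ∧ ∀ t, r' ≤ t → (e.cfg t u).synch = true ∧ e.Continues t u := by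
  have : ∃ r', r ≤ r' ∧ (e.cfg r' u).synch = true := by
    by_contra! hn
    obtain ⟨t, ht, ha⟩ := exists_active hf r u
    have h1 := hn t ht
    rcases e.stage_cases' t u with hu | hu | hu | hu
    · exact hu.inactive ha
    · exact hn (t + 1) (by omega) hu.synch
    · exact h1 hu.synch₀
    · exact h1 hu.guard.1
  obtain ⟨r', hr, hs⟩ := this
  refine ⟨r', hr, continues_or_of_phase_eq (fun t ht => ?_) hs⟩
  rw [hp t (by omega), hp r' hr]

theorem Continues.refreshes (h : e.Continues t u) (ha : u ∈ e.active t) : e.Refreshes t u := by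
  rcases e.stage_cases t u with hu | hu | hu | hu
  · exact absurd ha hu.inactive
  · have := h.synch₀
    simp [hu.synch₀] at this
  · exact hu
  · have := h.synch
    simp [hu.synch] at this

/-- If the port stays unblocked, an activation sets its `ack` flag or performs BLOCK. -/
theorem Refreshes.ack_or_block (h : e.Refreshes t u) (hl : (e.net t).link u ℓ = some (v, m))
    (hv : ℓ ∈ (e.cfg t u).valid) (hb : (e.cfg t u).block ℓ = false)
    (hp : (e.cfg t v).phase = (e.cfg t u).phase) :
    ((e.cfg t v).ack m = true → (e.cfg (t + 1) u).block ℓ = true) ∧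
      ((e.cfg t v).ack m = false → (e.cfg (t + 1) u).ack ℓ = true) := by
  have hvis : e.Visits t u ℓ ((e.cfg t v).ack m) := by
    refine ⟨⟨by rw [h.P]; exact hv.1, by rw [h.Dt]; exact hv.2⟩, hb, ?_⟩
    obtain ⟨x, hx, hxp⟩ := (e.consistent t).pulled u h.synch₀ ℓ hv.1
    by_cases hlt : x.phase < (e.cfg t u).phase
    · rw [h.X_eq_fresh hv hl hx hlt]
      exact ⟨_, rfl, hp, rfl⟩
    · rw [h.X_eq_ack hv hl hx hlt]
      exact ⟨_, rfl, le_antisymm hxp (not_lt.mp hlt), rfl⟩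
  constructor <;> intro ha <;> rw [ha] at hvis
  · exact (h.block ℓ).2 (Or.inr (Or.inl ((h.blocks ℓ).2 hvis)))
  · exact (h.ack ℓ).2 (Or.inr hvis)

theorem Continues.ack_mono (h : e.Continues t u) (ha : (e.cfg t u).ack ℓ = true) :
    (e.cfg (t + 1) u).ack ℓ = true := by
  have h1 := h.synch₀
  have h2 := h.synch
  rcases e.stage_cases t u with hu | hu | hu | hu
  · rwa [hu.ack]
  · simp [hu.synch₀] at h1
  · exact (hu.ack ℓ).2 (Or.inl ha)
  · simp [hu.synch] at h2

theorem Continues.Dt_mono (h : e.Continues t u) : (e.cfg t u).Dt ⊆ (e.cfg (t + 1) u).Dt := by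
  have h1 := h.synch₀
  have h2 := h.synch
  rcases e.stage_cases t u with hu | hu | hu | hu
  · rw [hu.Dt]
  · simp [hu.synch₀] at h1
  · rw [hu.Dt]
    exact Set.subset_union_left
  · simp [hu.synch] at h2

theorem eventually_settled (hf : e.WeaklyFair) {r i : ℕ} (hmin : ∀ v, i ≤ (e.cfg r v).phase)
    (hp : ∀ t, r ≤ t → (e.cfg t u).phase = i)
    (hc : ∀ t, r ≤ t → (e.cfg t u).synch = true ∧ e.Continues t u) (ℓ : Fin Δ) :
    ∃ t, r ≤ t ∧ (ℓ ∉ (e.cfg t u).P \ (e.cfg t u).Dt ∨ (e.cfg t u).block ℓ = true) := by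
  by_contra! hn
  simp only [ne_eq, Bool.not_eq_true] at hn
  have hval : ∀ t, r ≤ t → ℓ ∈ (e.cfg t u).valid := by
    intro t ht
    refine ⟨(hn t ht).1.1, ?_⟩
    rintro (hD | hD)
    · exact (hn t ht).1.2 hD
    -- A detected disconnection stays in `D` until the next activation, which moves it to `Dt`,
    -- against the assumption on `ℓ`.
    · have hpers : ∀ t', t ≤ t' → ℓ ∈ (e.cfg t' u).D := by
        intro t' ht'
        induction t', ht' using Nat.le_induction with
        | base => exact hD
        | succ t' ht' ih =>
          have h1 := (hc t' (by omega)).2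
          by_cases ha : u ∈ e.active t'
          · have h2 := h1.refreshes ha
            exfalso
            refine (hn (t' + 1) (by omega)).1.2 ?_
            rw [h2.Dt]
            exact Or.inr ih
          · rcases e.stage_cases t' u with hu | hu | hu | hu
            · rw [hu.D]
              exact Or.inl ih
            · exact absurd hu.active ha
            · exact absurd hu.active ha
            · exact absurd hu.active ha
      obtain ⟨t', ht', ha⟩ := exists_active hf t u
      refine (hn (t' + 1) (by omega)).1.2 ?_
      rw [((hc t' (by omega)).2.refreshes ha).Dt]
      exact Or.inr (hpers t' ht')
  obtain ⟨v, m, hl⟩ : ∃ v m, ∀ t, r ≤ t → (e.net t).link u ℓ = some (v, m) := by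
    obtain ⟨v, m, hl, -⟩ := (e.consistent r).edge u ℓ (hc r le_rfl).1 (hval r le_rfl)
    refine ⟨v, m, fun t ht => ?_⟩
    induction t, ht using Nat.le_induction with
    | base => exact hl
    | succ t ht ih =>
      exact link_succ ih (((hc t ht).2.mem_valid ℓ).1 (hval (t + 1) (by omega))).2
  have hcomp := fun t ht => ((e.consistent t).edge_of_link (hl t ht) (hc t ht).1 (hval t ht)).2
  -- The neighbour cannot be behind, by minimality, nor ahead, since `ℓ` is unblocked.
  have hpv : ∀ t, r ≤ t → (e.cfg t v).phase = i := by
    intro t ht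
    have h1 := hmin v
    have h2 : (e.cfg r v).phase ≤ (e.cfg t v).phase := e.phase_mono v ht
    have h3 := hp t ht
    rcases hcomp t ht with h4 | h4 | h4 | h4
    · omega
    · omega
    · omega
    · simp [(hn t ht).2] at h4
  obtain ⟨r₁, hr₁, hcv⟩ := eventually_synch (u := v) (r := r) hf fun t ht => by
    rw [hpv t ht, hpv r le_rfl]
  have hvv : ∀ t, r₁ ≤ t → m ∈ (e.cfg t v).valid ∧ (e.cfg t v).block m = false := by
    intro t ht
    have h1 := hp t (by omega)
    have h2 := hpv t (by omega)
    rcases hcomp t (by omega) with h4 | h4 | h4 | h4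
    · omega
    · simp [(hcv t ht).1] at h4
    · exact ⟨h4.2.2.1, by rw [← h4.2.2.2, (hn t (by omega)).2]⟩
    · omega
  -- An activated `u` either raises its `ack` or performs BLOCK, which is excluded. The next
  -- activation of `v` then reads this `ack` and must perform BLOCK.
  have hacku : ∃ r₂, r₁ ≤ r₂ ∧ (e.cfg r₂ u).ack ℓ = true := by
    obtain ⟨t, ht, ha⟩ := exists_active hf r₁ u
    have hu := (hc t (by omega)).2.refreshes ha
    have h1 := hu.ack_or_block (hl t (by omega)) (hval t (by omega)) (hn t (by omega)).2
      (by rw [hp t (by omega), hpv t (by omega)])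
    refine ⟨t + 1, by omega, h1.2 ?_⟩
    by_contra h2
    have := h1.1 (by simpa using h2)
    simp [(hn (t + 1) (by omega)).2] at this
  obtain ⟨r₂, hr₂, hau⟩ := hacku
  have hau' : ∀ t, r₂ ≤ t → (e.cfg t u).ack ℓ = true := by
    intro t ht
    induction t, ht using Nat.le_induction with
    | base => exact hau
    | succ t ht ih => exact (hc t (by omega)).2.ack_mono ih
  obtain ⟨t, ht, ha⟩ := exists_active hf r₂ v
  have hv := (hcv t (by omega)).2.refreshes ha
  have h1 := (hv.ack_or_block ((e.net t).symm _ _ _ _ (hl t (by omega))) (hvv t (by omega)).1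
    (hvv t (by omega)).2 (by rw [hp t (by omega), hpv t (by omega)])).1 (hau' t ht)
  simp [(hvv (t + 1) (by omega)).2] at h1

theorem exists_phase_succ (hf : e.WeaklyFair) {r i : ℕ} (hmin : ∀ v, i ≤ (e.cfg r v).phase)
    (hu : (e.cfg r u).phase = i) : ∃ t, r ≤ t ∧ e.Executes t u ∧ (e.cfg t u).phase = i := by
  by_contra! hn
  have hp : ∀ t, r ≤ t → (e.cfg t u).phase = i := by
    intro t ht
    induction t, ht using Nat.le_induction with
    | base => exact hu
    | succ t ht ih =>
      rcases e.phase_succ t u with h | h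
      · omega
      · exact absurd ih (hn t ht h.2)
  obtain ⟨r₁, hr₁, hc⟩ := eventually_synch (u := u) (r := r) hf fun t ht => by rw [hp t ht, hu]
  have hset := eventually_settled hf (r := r₁) (i := i) (u := u)
    (fun v => (hmin v).trans (e.phase_mono v hr₁)) (fun t ht => hp t (by omega)) hc
  choose T hT hT' using hset
  obtain ⟨R, hR⟩ : ∃ R, r₁ ≤ R ∧ ∀ ℓ, T ℓ ≤ R := by
    obtain ⟨R, hR⟩ := (Set.finite_range T).bddAbove
    exact ⟨max R r₁, le_max_right _ _, fun ℓ => (hR ⟨ℓ, rfl⟩).trans (le_max_left _ _)⟩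
  have hset : ∀ ℓ t, T ℓ ≤ t →
      (ℓ ∉ (e.cfg t u).P \ (e.cfg t u).Dt ∨ (e.cfg t u).block ℓ = true) := by
    intro ℓ t ht
    induction t, ht using Nat.le_induction with
    | base => exact hT' ℓ
    | succ t ht ih =>
      have h1 := (hc t ((hT ℓ).trans ht)).2
      rcases ih with ih | ih
      · refine Or.inl fun h2 => ih ?_
        rw [h1.P] at h2
        exact ⟨h2.1, fun h3 => h2.2 (h1.Dt_mono h3)⟩
      · exact Or.inr ((h1.block ℓ).2 (Or.inl ih))
  obtain ⟨t, ht, ha⟩ := exists_active hf R u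
  obtain ⟨hs, h1⟩ := hc t (by omega)
  -- With all ports settled, the activation must be EXECUTESYNCH, whereas a constant phase forces
  -- HANDSHAKE.
  refine KState.not_executeGuard_of_handshakeGuard (h1.refreshes ha).guard ⟨hs, fun ℓ hℓ => ?_⟩
  exact (hset ℓ t ((hR.2 ℓ).trans ht)).resolve_left (not_not.mpr hℓ)

/-- Take the first stage at which all phases exceed `i`. One stage before, some node was still at
`i` or below, and phases grow by at most one. -/
theorem exists_isMinPhase_succ [Finite V] (hf : e.WeaklyFair) {r i : ℕ} (h : e.IsMinPhase r i) :
    ∃ r', r < r' ∧ e.IsMinPhase r' (i + 1) := by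
  classical
  have hmin : ∀ v, i ≤ (e.cfg r v).phase := fun v => h.2 ⟨v, rfl⟩
  have hex : ∃ t, r ≤ t ∧ ∀ v, i + 1 ≤ (e.cfg t v).phase := by
    have : ∀ v, ∃ t, i + 1 ≤ (e.cfg t v).phase := by
      intro v
      by_cases hv : (e.cfg r v).phase = i
      · obtain ⟨t, -, h1, h2⟩ := exists_phase_succ hf hmin hv
        exact ⟨t + 1, by rw [h1.phase, h2]⟩
      · exact ⟨r, by have := hmin v; omega⟩
    choose T hT using this
    obtain ⟨R, hR⟩ := (Set.finite_range T).bddAbove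
    exact ⟨max R r, le_max_right _ _, fun v =>
      (hT v).trans (e.phase_mono v ((hR ⟨v, rfl⟩).trans (le_max_left _ _)))⟩
  obtain ⟨w, hw⟩ := h.1
  obtain ⟨h1, h2⟩ := Nat.find_spec hex
  have hlt : r < Nat.find hex := by
    refine lt_of_le_of_ne h1 fun h3 => ?_
    rw [← h3] at h2
    have := h2 w
    simp only at hw
    omega
  refine ⟨Nat.find hex, hlt, ?_, ?_⟩
  · obtain ⟨k, hk⟩ := Nat.exists_eq_succ_of_ne_zero (by omega : Nat.find hex ≠ 0)
    have h3 := Nat.find_min hex (m := k) (by omega)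
    push Not at h3
    obtain ⟨v, hv⟩ := h3 (by omega)
    refine ⟨v, ?_⟩
    have h4 := h2 v
    rw [hk] at h4 ⊢
    simp only
    rcases e.phase_succ k v with h5 | h5 <;> simp only [Nat.succ_eq_add_one] at * <;> omega
  · rintro _ ⟨v, rfl⟩
    exact h2 v

/-- The minimum phase reaches `i`, so `u` gets at least that far, and unit increments skip no value.
-/
theorem exists_phase_eq [Finite V] (hf : e.WeaklyFair) (u : V) (i : ℕ) :
    ∃ t, (e.cfg t u).phase = i := by
  classical
  have hmin : ∃ r, e.IsMinPhase r i := by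
    induction i with
    | zero => exact ⟨0, ⟨u, by simp [e.init, KState.initial]⟩, fun _ _ => Nat.zero_le _⟩
    | succ i ih =>
      obtain ⟨r, hr⟩ := ih
      obtain ⟨r', -, hr'⟩ := exists_isMinPhase_succ hf hr
      exact ⟨r', hr'⟩
  obtain ⟨r, hr⟩ := hmin
  have hle : i ≤ (e.cfg r u).phase := hr.2 ⟨u, rfl⟩
  have hgen : ∀ r, ∀ i ≤ (e.cfg r u).phase, ∃ t, (e.cfg t u).phase = i := by
    intro r
    induction r with
    | zero =>
      intro i hi
      exact ⟨0, by simp [e.init, KState.initial] at hi ⊢; omega⟩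
    | succ r ih =>
      intro i hi
      by_cases h : i ≤ (e.cfg r u).phase
      · exact ih i h
      · refine ⟨r + 1, ?_⟩
        rcases e.phase_succ r u with h5 | h5 <;> omega
  exact hgen r i hle

end SemiExecution

namespace SemiExecution

variable {V : Type*} {Δ : ℕ} {Main Port Act : Type*} {A : SyncAlgorithm Δ Main Port Act}
  {x₀ : V → AlgState Δ Main Port} {e : SemiExecution A x₀} {t : ℕ} {u v : V} {ℓ m : Fin Δ}

/-! ### From the synchronizer to a synchronous execution -/

/-- The stage in which `u` starts phase `i`. -/
noncomputable def startStage (e : SemiExecution A x₀) (u : V) (i : ℕ) : ℕ :=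
  sInf {t | (e.cfg (t + 1) u).phase = i ∧ (e.cfg (t + 1) u).synch = true}

/-- The state of the simulated algorithm at `u` during phase `i`. -/
noncomputable def phaseState (e : SemiExecution A x₀) (i : ℕ) (u : V) : AlgState Δ Main Port :=
  (e.cfg (sInf {t | (e.cfg t u).phase = i}) u).alg

/-- In phase `i`, the ends `u` and `v` of an edge agree to communicate. -/
def Linked (e : SemiExecution A x₀) (i : ℕ) (u : V) (ℓ : Fin Δ) (v : V) (m : Fin Δ) : Prop :=
  ∃ t, (e.net t).link u ℓ = some (v, m) ∧ (e.cfg t u).phase = i ∧ (e.cfg t v).phase = i ∧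
    (e.Blocks t u ℓ ∨ e.Blocks t v m)

theorem Linked.symm {i : ℕ} (h : e.Linked i u ℓ v m) : e.Linked i v m u ℓ := by
  obtain ⟨t, h1, h2, h3, h4⟩ := h
  exact ⟨t, (e.net t).symm _ _ _ _ h1, h3, h2, h4.symm⟩

/-- A property that a stage preserves unless the phase changes persists until the phase changes. -/
theorem persists {p : ℕ → Prop} {s t : ℕ} (hst : s ≤ t)
    (hp : (e.cfg s u).phase = (e.cfg t u).phase) (hs : p s)
    (hstep : ∀ k, (e.cfg (k + 1) u).phase = (e.cfg k u).phase → p k → p (k + 1)) : p t := by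
  have key : ∀ k, s ≤ k → k ≤ t → p k ∧ (e.cfg k u).phase = (e.cfg t u).phase := by
    intro k hk
    induction k, hk using Nat.le_induction with
    | base => exact fun _ => ⟨hs, hp⟩
    | succ k hk ih =>
      intro hkt
      obtain ⟨h1, h2⟩ := ih (by omega)
      have h3 : (e.cfg (k + 1) u).phase ≤ (e.cfg t u).phase := e.phase_mono u hkt
      have h4 := e.phase_le_succ k u
      exact ⟨hstep k (by omega) h1, by omega⟩
  exact (key t hst le_rfl).1

theorem synch_succ (hp : (e.cfg (t + 1) u).phase = (e.cfg t u).phase)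
    (hs : (e.cfg t u).synch = true) : (e.cfg (t + 1) u).synch = true := by
  rcases e.stage_cases' t u with hu | hu | hu | hu
  · simp [hu.synch₀] at hs
  · exact hu.synch
  · exact hu.synch
  · have := hu.phase
    omega

theorem block_succ_of_phase_eq (hp : (e.cfg (t + 1) u).phase = (e.cfg t u).phase)
    (hb : (e.cfg t u).block ℓ = true) : (e.cfg (t + 1) u).block ℓ = true := by
  rcases e.stage_cases t u with hu | hu | hu | hu
  · exact (hu.block ℓ).2 (Or.inl hb)
  · exact (hu.block ℓ).2 (Or.inl hb)
  · exact (hu.block ℓ).2 (Or.inl hb)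
  · have := hu.phase
    omega

theorem alg_succ (hp : (e.cfg (t + 1) u).phase = (e.cfg t u).phase) :
    (e.cfg (t + 1) u).alg = (e.cfg t u).alg := by
  rcases e.stage_cases t u with hu | hu | hu | hu
  · exact hu.alg
  · exact hu.alg
  · exact hu.alg
  · have := hu.phase
    omega

theorem alg_eq_phaseState (e : SemiExecution A x₀) (t : ℕ) (u : V) :
    (e.cfg t u).alg = e.phaseState (e.cfg t u).phase u := by
  have h1 : sInf {s | (e.cfg s u).phase = (e.cfg t u).phase} ≤ t := Nat.sInf_le rfl
  have h2 := Nat.sInf_mem (s := {s | (e.cfg s u).phase = (e.cfg t u).phase}) ⟨t, rfl⟩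
  exact persists (p := fun k => (e.cfg k u).alg = e.phaseState (e.cfg t u).phase u) h1 h2 rfl
    fun k hk hp => (alg_succ hk).trans hp

/-- A phase is started only once: after an earlier start, `synch` would still be set. -/
theorem Starts.startStage_eq (h : e.Starts t u) : e.startStage u (e.cfg t u).phase = t := by
  have hmem : t ∈ {s | (e.cfg (s + 1) u).phase = (e.cfg t u).phase ∧
    (e.cfg (s + 1) u).synch = true} := ⟨h.phase, h.synch⟩
  refine le_antisymm (Nat.sInf_le hmem) ?_
  by_contra! hlt
  obtain ⟨h1, h2⟩ := Nat.sInf_mem ⟨t, hmem⟩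
  have := persists (e := e) (u := u) (p := fun k => (e.cfg k u).synch = true)
    (Nat.succ_le_of_lt hlt) h1 h2 fun k hk hp => synch_succ hk hp
  simp [h.synch₀] at this

/-- A valid edge is the one that was present at the start of the phase. -/
theorem link_startStage (e : SemiExecution A x₀) (t : ℕ) (u : V) (ℓ : Fin Δ)
    (hs : (e.cfg t u).synch = true) (hv : ℓ ∈ (e.cfg t u).valid) :
    (e.net (e.startStage u (e.cfg t u).phase)).link u ℓ = (e.net t).link u ℓ := by
  induction t with
  | zero => simp [e.init, KState.initial] at hs
  | succ t ih =>
    rcases e.stage_cases' t u with hu | hu | hu | hu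
    · simp [hu.synch] at hs
    · obtain ⟨hP, hlost⟩ := hu.mem_valid.1 hv
      obtain ⟨v, m, hl⟩ := hu.exists_link hP
      rw [hu.phase, hu.startStage_eq, hl, link_succ hl hlost]
    · obtain ⟨hv', hlost⟩ := (hu.mem_valid ℓ).1 hv
      obtain ⟨v, m, hl, -⟩ := (e.consistent t).edge u ℓ hu.synch₀ hv'
      rw [hu.phase, ih hu.synch₀ hv', hl, link_succ hl hlost]
    · simp [hu.synch] at hs

theorem Refreshes.valid_of_visits {a : Bool} (h : e.Refreshes t u) (hb : e.Visits t u ℓ a) :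
    ℓ ∈ (e.cfg t u).valid := by
  have := hb.1
  rwa [h.P, h.Dt] at this

/-- BLOCK uses an edge that is valid at both ends, and a valid edge has been present since the start
of the phase. With `Linked.symm` this covers both ends, although they may start in different stages.
-/
theorem Linked.link_eq {i : ℕ} (h : e.Linked i u ℓ v m) :
    (e.net (e.startStage u i)).link u ℓ = some (v, m) := by
  obtain ⟨t, hl, rfl, h2, hb | hb⟩ := h
  · rcases e.stage_cases t u with hu | hu | hu | hu
    · exact absurd hb hu.not_blocks
    · rw [hu.startStage_eq, hl]
    · rw [link_startStage e t u ℓ hu.synch₀ (hu.valid_of_visits ((hu.blocks ℓ).1 hb)), hl]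
    · exact absurd hb hu.not_blocks
  · obtain ⟨-, hs, hv, -⟩ := (e.consistent t).blocks_spec ((e.net t).symm _ _ _ _ hl) hb
    rw [link_startStage e t u ℓ hs hv, hl]

/-- With `Linked.block_of_executes`, this identifies the ports used by EXECUTESYNCH with the linked
ones. -/
theorem exists_linked_of_block (e : SemiExecution A x₀) (t : ℕ) (u : V) (ℓ : Fin Δ)
    (hb : (e.cfg t u).block ℓ = true) : ∃ v m, e.Linked (e.cfg t u).phase u ℓ v m := by
  have key : ∀ t, e.Blocks t u ℓ ∨
      BlockedByNeighbor (e.net t) (e.active t) (e.cfg t) u ℓ →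
      ∃ v m, e.Linked (e.cfg t u).phase u ℓ v m := by
    rintro t (hb | hb)
    · have hl : ∃ v m, (e.net t).link u ℓ = some (v, m) := by
        rcases e.stage_cases t u with hu | hu | hu | hu
        · exact absurd hb hu.not_blocks
        · exact hu.exists_link ((hu.blocks ℓ).1 hb).1.1
        · obtain ⟨v, m, hl, -⟩ := (e.consistent t).edge u ℓ hu.synch₀
            (hu.valid_of_visits ((hu.blocks ℓ).1 hb))
          exact ⟨v, m, hl⟩
        · exact absurd hb hu.not_blocks
      obtain ⟨v, m, hl⟩ := hl
      exact ⟨v, m, t, hl, rfl, ((e.consistent t).blocks_spec hl hb).1, Or.inl hb⟩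
    · obtain ⟨-, -, -, -, v, m, hl, hp, hb⟩ := (e.consistent t).blockedByNeighbor_spec hb
      exact ⟨v, m, t, hl, rfl, hp, Or.inr hb⟩
  induction t with
  | zero => simp [e.init, KState.initial] at hb
  | succ t ih =>
    rcases e.stage_cases t u with hu | hu | hu | hu
    · rw [hu.phase]
      rcases (hu.block ℓ).1 hb with hb | hb
      · exact ih hb
      · exact key t (Or.inr hb)
    · rw [hu.phase]
      rcases (hu.block ℓ).1 hb with hb | hb
      · exact ih hb
      · exact key t hb
    · rw [hu.phase]
      rcases (hu.block ℓ).1 hb with hb | hb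
      · exact ih hb
      · exact key t hb
    · simp [(e.consistent t).executes_block hu] at hb

theorem Linked.block_of_executes {i : ℕ} (h : e.Linked i u ℓ v m) (hu : e.Executes t u)
    (hi : (e.cfg t u).phase = i) : (e.cfg t u).block ℓ = true := by
  obtain ⟨s, hl, h1, h2, hb⟩ := h
  have hb' : (e.cfg (s + 1) u).block ℓ = true ∧ (e.cfg (s + 1) u).phase = i := by
    rw [← blockedByNeighbor_iff e hl] at hb
    rcases e.stage_cases s u with hs | hs | hs | hs
    · exact ⟨(hs.block ℓ).2 (Or.inr (hb.resolve_left hs.not_blocks)), hs.phase.trans h1⟩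
    · exact ⟨(hs.block ℓ).2 (Or.inr hb), hs.phase.trans h1⟩
    · exact ⟨(hs.block ℓ).2 (Or.inr hb), hs.phase.trans h1⟩
    -- In the stage of the BLOCK, `u` is not executing, as its port is still valid and unblocked.
    · obtain ⟨-, h3, h4, -⟩ := (e.consistent s).blockedByNeighbor_spec
        (hb.resolve_left hs.not_blocks)
      simp [hs.block_of_valid h3] at h4
  have hst : s + 1 ≤ t := by
    by_contra! hlt
    have h3 : (e.cfg (t + 1) u).phase ≤ (e.cfg (s + 1) u).phase := e.phase_mono u (by omega)
    have := hu.phase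
    omega
  exact persists (p := fun k => (e.cfg k u).block ℓ = true) hst (hb'.2.trans hi.symm) hb'.1
    fun k hk hp => block_succ_of_phase_eq hk hp

/-- The data pulled from a neighbour in the same phase are its state in that phase. -/
theorem stored_eq_phaseState (e : SemiExecution A x₀) (t : ℕ) (u : V) (ℓ : Fin Δ)
    (hs : (e.cfg t u).synch = true) (hP : ℓ ∈ (e.cfg t u).P) {x : Pulled Δ Main Port}
    (hx : (e.cfg t u).X ℓ = some x) (hxp : x.phase = (e.cfg t u).phase) :
    ∃ v m, (e.net (e.startStage u (e.cfg t u).phase)).link u ℓ = some (v, m) ∧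
      x.algMain = (e.phaseState (e.cfg t u).phase v).1 ∧
      x.algPort = (e.phaseState (e.cfg t u).phase v).2 m := by
  induction t generalizing x with
  | zero => simp [e.init, KState.initial] at hs
  | succ t ih =>
    have fresh : ∀ {t v m}, x = (e.cfg t v).expose m → x.phase = (e.cfg t u).phase →
        x.algMain = (e.phaseState (e.cfg t u).phase v).1 ∧
          x.algPort = (e.phaseState (e.cfg t u).phase v).2 m := by
      rintro t v m rfl h
      rw [← h]
      simp only [KState.expose, e.alg_eq_phaseState t v, and_self]
    rcases e.stage_cases t u with hu | hu | hu | hu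
    · rw [hu.synch] at hs
      rw [hu.P] at hP
      rw [hu.X] at hx
      rw [hu.phase] at hxp ⊢
      exact ih hs hP hx hxp
    · obtain ⟨v, m, hl⟩ := hu.exists_link hP
      rw [hu.X_eq hl] at hx
      rw [hu.phase] at hxp ⊢
      rw [hu.startStage_eq]
      exact ⟨v, m, hl, fresh (Option.some.inj hx).symm hxp⟩
    · rw [hu.P] at hP
      rw [hu.phase] at hxp ⊢
      by_cases hv : ℓ ∈ (e.cfg t u).valid
      · obtain ⟨v, m, hl, -⟩ := (e.consistent t).edge u ℓ hu.synch₀ hv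
        obtain ⟨y, hy, -⟩ := (e.consistent t).pulled u hu.synch₀ ℓ hP
        by_cases hlt : y.phase < (e.cfg t u).phase
        · rw [hu.X_eq_fresh hv hl hy hlt] at hx
          rw [link_startStage e t u ℓ hu.synch₀ hv]
          exact ⟨v, m, hl, fresh (Option.some.inj hx).symm hxp⟩
        · rw [hu.X_eq_ack hv hl hy hlt] at hx
          obtain rfl := Option.some.inj hx
          exact ih (x := y) hu.synch₀ hP hy hxp
      · rw [hu.X_eq_of_not_valid hv] at hx
        exact ih hu.synch₀ hP hx hxp
    · simp [hu.synch] at hs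

open Classical in
/-- The network of the edges over which the nodes communicate in phase `i`. -/
noncomputable def phaseNet (e : SemiExecution A x₀) (i : ℕ) : Snapshot V Δ where
  link u ℓ := if ∃ q : V × Fin Δ, e.Linked i u ℓ q.1 q.2 then
    (e.net (e.startStage u i)).link u ℓ else none
  symm u ℓ v m h := by
    split_ifs at h with h1
    obtain ⟨⟨v', m'⟩, hq⟩ := h1
    rw [hq.link_eq] at h
    obtain ⟨rfl, rfl⟩ : v' = v ∧ m' = m := by simpa using h
    rw [if_pos ⟨(u, ℓ), hq.symm⟩, hq.symm.link_eq]
  loopless u ℓ m h := by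
    split_ifs at h
    exact Snapshot.loopless _ _ _ _ h
  -- All ports of one node are read from a single snapshot, that of its own start, so simplicity is
  -- inherited; only symmetry compares two snapshots.
  simple u v ℓ m ℓ' m' h h' := by
    split_ifs at h
    split_ifs at h'
    exact Snapshot.simple _ _ _ _ _ _ _ h h'

theorem Linked.phaseNet_link {i : ℕ} (h : e.Linked i u ℓ v m) :
    (e.phaseNet i).link u ℓ = some (v, m) := by
  simp only [phaseNet]
  rw [if_pos ⟨(v, m), h⟩, h.link_eq]

theorem Executes.simView_eq (h : e.Executes t u) :
    (e.cfg t u).simView =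
      syncView (e.phaseNet (e.cfg t u).phase) (e.phaseState (e.cfg t u).phase) u := by
  funext ℓ
  by_cases hb : (e.cfg t u).block ℓ = true
  · obtain ⟨v, m, hl⟩ := exists_linked_of_block e t u ℓ hb
    obtain ⟨hP, x, hx, hxp⟩ := (e.consistent t).block u ℓ hb
    obtain ⟨v', m', hl', h1, h2⟩ := stored_eq_phaseState e t u ℓ h.guard.1 hP hx hxp
    rw [hl.link_eq] at hl'
    obtain ⟨rfl, rfl⟩ : v = v' ∧ m = m' := by simpa using hl'
    simp only [KState.simView, syncView, hl.phaseNet_link]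
    rw [if_pos ⟨hP, hb⟩]
    simp [hx, h1, h2]
  · have hn : ¬ ∃ q : V × Fin Δ, e.Linked (e.cfg t u).phase u ℓ q.1 q.2 := by
      rintro ⟨q, hq⟩
      exact hb (hq.block_of_executes h rfl)
    simp only [KState.simView, syncView, phaseNet]
    rw [if_neg fun h => hb h.2, if_neg hn]
    rfl

theorem exists_executes [Finite V] (hf : e.WeaklyFair) (u : V) (i : ℕ) :
    ∃ t, e.Executes t u ∧ (e.cfg t u).phase = i := by
  classical
  have hex : ∃ t, (e.cfg t u).phase = i + 1 := exists_phase_eq hf u (i + 1)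
  have h1 := Nat.find_spec hex
  have h0 : Nat.find hex ≠ 0 := by
    intro h0
    rw [h0] at h1
    simp [e.init, KState.initial] at h1
  obtain ⟨k, hk⟩ := Nat.exists_eq_succ_of_ne_zero h0
  have h2 := Nat.find_min hex (m := k) (by omega)
  rw [hk, Nat.succ_eq_add_one] at h1
  rcases e.phase_succ k u with h3 | ⟨h3, h4⟩
  · omega
  · exact ⟨k, h4, by omega⟩

/-- The synchronous execution that is simulated by an execution of the synchronizer. -/
noncomputable def toSync [Finite V] (e : SemiExecution A x₀) (hf : e.WeaklyFair) :
    SyncExecution A x₀ where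
  net := e.phaseNet
  state := e.phaseState
  init := by
    funext u
    have := e.alg_eq_phaseState 0 u
    simpa [e.init, KState.initial] using this.symm
  step i u := by
    obtain ⟨t, h, rfl⟩ := exists_executes hf u i
    have h1 := h.alg
    rwa [e.alg_eq_phaseState t u, e.alg_eq_phaseState (t + 1) u, h.phase, h.simView_eq] at h1

/-- Once every node has reached phase `T`, any action run later would be enabled in a stage of the
simulated execution not before `T`. -/
theorem terminates_of_toSync [Finite V] (hf : e.WeaklyFair) (h : (e.toSync hf).Terminates) :
    e.Terminates := by
  obtain ⟨T, hT⟩ := h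
  have hR : ∃ R, ∀ u, T ≤ (e.cfg R u).phase := by
    choose r hr using fun u => exists_phase_eq hf u T
    obtain ⟨R, hR⟩ := (Set.finite_range r).bddAbove
    exact ⟨R, fun u => (hr u).ge.trans (e.phase_mono u (hR ⟨u, rfl⟩))⟩
  obtain ⟨R, hR⟩ := hR
  refine ⟨R, fun t ht u ⟨ha, hg, hen⟩ => ?_⟩
  have hex : e.Executes t u := by
    rcases e.stage_cases t u with hu | hu | hu | hu
    · exact absurd ha hu.inactive
    · have := hg.1
      simp [hu.synch₀] at this
    · exact absurd hg (KState.not_executeGuard_of_handshakeGuard hu.guard)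
    · exact hu
  rw [hex.simView_eq, e.alg_eq_phaseState t u] at hen
  exact hT _ ((hR u).trans (e.phase_mono u ht)) u hen

end SemiExecution

namespace SyncExecution

variable {V : Type*} {Δ : ℕ} {Main Port Act : Type*} {A : SyncAlgorithm Δ Main Port Act}
  {x₀ : V → AlgState Δ Main Port} (s : SyncExecution A x₀) {k : ℕ} {u v : V} {ℓ m : Fin Δ}

/-! ### From a synchronous execution to the synchronizer -/

/-- The nodes activated in stage `n` of the simulation of `s`, from the memories `c`: every stage of
`s` is simulated by three stages, the last of which is used for EXECUTESYNCH. -/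
def simActive (n : ℕ) (c : V → KState Δ Main Port) : Set V :=
  {u | if n % 3 = 2 then
    (c u).ExecuteGuard ∧ A.Step (c u).alg (c u).simView (s.state (n / 3 + 1) u)
    else (c u).HandshakeGuard}

open Classical in
/-- The effect of stage `n` of the simulation on the memory of `u`, without that of the other nodes
and of the dynamics. -/
noncomputable def simActivation (n : ℕ) (c : V → KState Δ Main Port) (u : V) :
    KState Δ Main Port :=
  if u ∈ s.simActive n c then
    if n % 3 = 2 then (c u).execute (s.state (n / 3 + 1) u)
    else (c u).handshake (kPull (s.net (n / 3)) c u)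
  else c u

open Classical in
/-- The memories during the simulation of `s` by the synchronizer. -/
noncomputable def simCfg : ℕ → V → KState Δ Main Port
  | 0 => fun u => KState.initial (x₀ u)
  | n + 1 => fun u =>
    { s.simActivation n (simCfg n) u with
      block := fun ℓ =>
        if BlockedByNeighbor (s.net (n / 3)) (s.simActive n (simCfg n)) (simCfg n) u ℓ then true
        else (s.simActivation n (simCfg n) u).block ℓ
      D := (s.simActivation n (simCfg n) u).D ∪
        (s.net (n / 3)).lost (s.net ((n + 1) / 3)) u }

/-- The simulation of a synchronous execution by the synchronizer. -/
noncomputable def toSemi : SemiExecution A x₀ where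
  net n := s.net (n / 3)
  active n := s.simActive n (s.simCfg n)
  cfg := s.simCfg
  init := rfl
  active_enabled _ _ _ := KState.handshakeGuard_or_executeGuard _
  step n u := by
    refine ⟨s.simActivation n (s.simCfg n) u, fun h => ?_, fun h => ?_, rfl⟩
    · unfold simActivation
      rw [if_pos h]
      simp only [simActive, Set.mem_ofPred_eq] at h
      split_ifs at h with hn
      · rw [if_pos hn]
        exact Or.inr ⟨h.1, _, h.2, rfl⟩
      · rw [if_neg hn]
        exact Or.inl ⟨h, rfl⟩
    · unfold simActivation
      rw [if_neg h]

theorem toSemi_mem_active_handshake {n : ℕ} (hn : n % 3 ≠ 2) :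
    u ∈ s.toSemi.active n ↔ (s.toSemi.cfg n u).HandshakeGuard := by
  simp [toSemi, simActive, hn]

theorem toSemi_mem_active_execute {n : ℕ} (hn : n % 3 = 2) :
    u ∈ s.toSemi.active n ↔ (s.toSemi.cfg n u).ExecuteGuard ∧
      A.Step (s.toSemi.cfg n u).alg (s.toSemi.cfg n u).simView (s.state (n / 3 + 1) u) := by
  simp [toSemi, simActive, hn]

theorem toSemi_alg_succ {n : ℕ} (hn : n % 3 = 2) (hu : u ∈ s.toSemi.active n) :
    (s.toSemi.cfg (n + 1) u).alg = s.state (n / 3 + 1) u := by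
  change (s.simActivation n (s.simCfg n) u).alg = _
  unfold simActivation
  rw [if_pos (show u ∈ s.simActive n (s.simCfg n) from hu), if_pos hn]
  rfl

theorem toSemi_net {n : ℕ} (hn : n / 3 = k) : s.toSemi.net n = s.net k := by
  simp [toSemi, hn]

/-- Between the simulations of two stages. -/
def SimBetween (k n : ℕ) : Prop :=
  ∀ u, (s.toSemi.cfg n u).phase = k ∧ (s.toSemi.cfg n u).synch = false ∧
    (s.toSemi.cfg n u).alg = s.state k u

/-- After the first simulating stage. -/
structure SimStarted (k n : ℕ) (u : V) : Prop where
  phase : (s.toSemi.cfg n u).phase = k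
  synch : (s.toSemi.cfg n u).synch = true
  alg : (s.toSemi.cfg n u).alg = s.state k u
  P : ∀ ℓ, ℓ ∈ (s.toSemi.cfg n u).P ↔ (s.net k).link u ℓ ≠ none
  Dt : (s.toSemi.cfg n u).Dt = ∅
  D : (s.toSemi.cfg n u).D = ∅
  X : ∀ ℓ v m, (s.net k).link u ℓ = some (v, m) → ∃ x, (s.toSemi.cfg n u).X ℓ = some x ∧
    x.phase = k ∧ x.algMain = (s.state k v).1 ∧ x.algPort = (s.state k v).2 m
  ack : ∀ ℓ, (s.net k).link u ℓ ≠ none → (s.toSemi.cfg n u).ack ℓ = true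
  block : ∀ ℓ, (s.toSemi.cfg n u).block ℓ = false

/-- After the second simulating stage. -/
structure SimReady (k n : ℕ) (u : V) : Prop where
  phase : (s.toSemi.cfg n u).phase = k
  alg : (s.toSemi.cfg n u).alg = s.state k u
  guard : (s.toSemi.cfg n u).ExecuteGuard
  simView : (s.toSemi.cfg n u).simView = syncView (s.net k) (s.state k) u

theorem lost_self (G : Snapshot V Δ) (u : V) : G.lost G u = ∅ := by
  simp [Snapshot.lost]

/-- All nodes start the same phase together, so no port is rejected. No `ack` is set yet, so every
occupied port gets its `ack` and nobody performs BLOCK. -/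
theorem SimBetween.started (h : s.SimBetween k (3 * k)) (u : V) :
    s.SimStarted k (3 * k + 1) u := by
  set e := s.toSemi with he
  have hc := e.consistent (3 * k)
  have hnet : e.net (3 * k) = s.net k := s.toSemi_net (by omega)
  have hnet' : e.net (3 * k + 1) = s.net k := s.toSemi_net (by omega)
  have hst : ∀ u, e.Starts (3 * k) u := by
    intro u
    have ha : u ∈ e.active (3 * k) :=
      (s.toSemi_mem_active_handshake (by omega)).2 (Or.inl (h u).2.1)
    rcases e.stage_cases (3 * k) u with hu | hu | hu | hu
    · exact absurd ha hu.inactive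
    · exact hu
    · have := (h u).2.1
      simp [← he, hu.synch₀] at this
    · have := (h u).2.1
      simp [← he, hu.guard.1] at this
  have hu := hst u
  have hP : ∀ ℓ, ℓ ∈ (e.cfg (3 * k + 1) u).P ↔ (s.net k).link u ℓ ≠ none := by
    intro ℓ
    constructor
    · intro hℓ
      obtain ⟨v, m, hl⟩ := hu.exists_link hℓ
      rw [hnet] at hl
      simp [hl]
    · intro hℓ
      obtain ⟨⟨v, m⟩, hl⟩ := Option.ne_none_iff_exists'.mp hℓ
      rw [← hnet] at hl
      rw [hu.mem_P hl]
      refine ⟨by rw [(h v).1, (h u).1], fun _ hs => ?_⟩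
      simp [(hst v).synch₀] at hs
  refine ⟨hu.phase.trans (h u).1, hu.synch, hu.alg.trans (h u).2.2, hP, hu.Dt, ?_, ?_, ?_, ?_⟩
  -- The graph is unchanged between these two stages, and losses from the preceding change of graph
  -- are discarded by the activation.
  · rw [hu.D, hnet, hnet', lost_self]
  · intro ℓ v m hl
    rw [← hnet] at hl
    rw [← (h v).2.2]
    exact ⟨_, hu.X_eq hl, (h v).1, rfl, rfl⟩
  · intro ℓ hℓ
    obtain ⟨⟨v, m⟩, hl⟩ := Option.ne_none_iff_exists'.mp hℓ
    rw [← hnet] at hl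
    refine (hu.ack ℓ).2 (Or.inr ⟨⟨(hP ℓ).2 hℓ, by simp [hu.Dt]⟩,
      (hc.clean u ℓ hu.synch₀).2, _, hu.X_eq hl, ?_, (hc.clean v m (h v).2.1).1⟩)
    exact (h v).1.trans (h u).1.symm
  · intro ℓ
    by_contra hb
    have hb' : e.Blocks (3 * k) u ℓ := by
      rcases (hu.block ℓ).1 (by simpa using hb) with hb | hb | hb
      · simp [(hc.clean u ℓ hu.synch₀).2] at hb
      · exact hb
      · have := (hc.blockedByNeighbor_spec hb).1
        simp [hu.synch₀] at this
    obtain ⟨v, m, hl⟩ := hu.exists_link ((hu.blocks ℓ).1 hb').1.1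
    have := (hc.blocks_spec hl hb').2.1
    simp [(hst v).synch₀] at this

/-- Every `ack` flag in use is now set, so each node performs BLOCK on all its edges, and its view
is the full synchronous one. -/
theorem SimStarted.ready (h : ∀ u, s.SimStarted k (3 * k + 1) u) (u : V) :
    s.SimReady k (3 * k + 2) u := by
  set e := s.toSemi with he
  have hc := e.consistent (3 * k + 1)
  have hnet : e.net (3 * k + 1) = s.net k := s.toSemi_net (by omega)
  have hvalid : ∀ u ℓ, (s.net k).link u ℓ ≠ none → ℓ ∈ (e.cfg (3 * k + 1) u).valid := by
    intro u ℓ hℓ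
    have h1 := (h u).D
    have h2 := (h u).Dt
    rw [← he] at h1 h2
    exact ⟨((h u).P ℓ).2 hℓ, by simp [h1, h2]⟩
  -- A node without edges has nothing to block: HANDSHAKE is not enabled there, and it idles.
  have hcases : e.Refreshes (3 * k + 1) u ∨
      (e.Idle (3 * k + 1) u ∧ ∀ ℓ, (s.net k).link u ℓ = none) := by
    have hs := (h u).synch
    rw [← he] at hs
    have ha := s.toSemi_mem_active_handshake (u := u) (n := 3 * k + 1) (by omega)
    rw [← he] at ha
    rcases e.stage_cases (3 * k + 1) u with hu | hu | hu | hu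
    · refine Or.inr ⟨hu, fun ℓ => ?_⟩
      by_contra hℓ
      refine hu.inactive (ha.2 (Or.inr ⟨ℓ, ⟨((h u).P ℓ).2 hℓ, ?_⟩, (h u).block ℓ⟩))
      have h2 := (h u).Dt
      rw [← he] at h2
      simp [h2]
    · simp [hu.synch₀] at hs
    · exact Or.inl hu
    · exact absurd hu.guard (KState.not_executeGuard_of_handshakeGuard (ha.1 hu.active))
  have hcont : e.Continues (3 * k + 1) u := by
    rcases hcases with hu | hu
    · exact hu.continues
    · exact hu.1.continues (h u).synch
  have hblock : ∀ ℓ, (s.net k).link u ℓ ≠ none → (e.cfg (3 * k + 2) u).block ℓ = true := by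
    intro ℓ hℓ
    obtain ⟨⟨v, m⟩, hl⟩ := Option.ne_none_iff_exists'.mp hℓ
    rcases hcases with hu | hu
    · refine (hu.ack_or_block (by rw [hnet, hl]) (hvalid u ℓ hℓ) ((h u).block ℓ)
        ((h v).phase.trans (h u).phase.symm)).1 ((h v).ack m ?_)
      simp [(s.net k).symm _ _ _ _ hl]
    · simp [hu.2] at hℓ
  have hP : ∀ ℓ, ℓ ∈ (e.cfg (3 * k + 2) u).P ↔ (s.net k).link u ℓ ≠ none := by
    intro ℓ
    rw [hcont.P]
    exact (h u).P ℓ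
  refine ⟨hcont.phase.trans (h u).phase, hcont.alg.trans (h u).alg,
    ⟨hcont.synch, fun ℓ hℓ => hblock ℓ ((hP ℓ).1 hℓ.1)⟩, ?_⟩
  funext ℓ
  simp only [KState.simView, syncView]
  cases hl : (s.net k).link u ℓ with
  | none => rw [if_neg fun hF => (hP ℓ).1 hF.1 hl]; rfl
  | some q =>
    have hℓ : (s.net k).link u ℓ ≠ none := by simp [hl]
    rw [if_pos ⟨(hP ℓ).2 hℓ, hblock ℓ hℓ⟩]
    obtain ⟨x, hx, hxp, h1, h2⟩ := (h u).X ℓ q.1 q.2 hl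
    rcases hcases with hu | hu
    · obtain ⟨y, hy, -, h3, h4⟩ := hc.refreshes_X hu hx (hxp.trans (h u).phase.symm)
      rw [hy]
      simp [h1, h2, h3, h4]
    · simp [hu.2] at hℓ

/-- `simActive` makes activation in the third stage conditional on the prescribed step of `A` being
possible, so that the simulation can be defined without knowledge of the memories. Here the
condition is discharged. -/
theorem SimReady.mem_active (h : s.SimReady k (3 * k + 2) u) :
    u ∈ s.toSemi.active (3 * k + 2) := by
  rw [s.toSemi_mem_active_execute (by omega)]
  refine ⟨h.guard, ?_⟩
  rw [h.simView, h.alg, show (3 * k + 2) / 3 = k by omega]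
  exact s.step k u

theorem SimReady.between (h : ∀ u, s.SimReady k (3 * k + 2) u) :
    s.SimBetween (k + 1) (3 * (k + 1)) := by
  intro u
  have ha := (h u).mem_active
  have hex : s.toSemi.Executes (3 * k + 2) u := by
    rcases s.toSemi.stage_cases (3 * k + 2) u with hu | hu | hu | hu
    · exact absurd ha hu.inactive
    · have := (h u).guard.1
      simp [hu.synch₀] at this
    · exact absurd (h u).guard (KState.not_executeGuard_of_handshakeGuard hu.guard)
    · exact hu
  rw [show 3 * (k + 1) = 3 * k + 2 + 1 by omega]
  refine ⟨by rw [hex.phase, (h u).phase], hex.synch, ?_⟩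
  rw [s.toSemi_alg_succ (by omega) ha, show (3 * k + 2) / 3 = k by omega]

theorem simBetween (k : ℕ) : s.SimBetween k (3 * k) := by
  induction k with
  | zero =>
    intro u
    simp [toSemi, simCfg, KState.initial, s.init]
  | succ k ih => exact SimReady.between s (SimStarted.ready s ih.started)

theorem simReady (k : ℕ) (u : V) : s.SimReady k (3 * k + 2) u :=
  SimStarted.ready s (s.simBetween k).started u

/-- Every node executes in the last stage of each block of three, and `3 * t + 2` is such a stage
after `t`. -/
theorem toSemi_weaklyFair : s.toSemi.WeaklyFair := fun u t _ =>
  ⟨3 * t + 2, by omega, (s.simReady t u).mem_active⟩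

theorem terminates_of_toSemi (h : s.toSemi.Terminates) : s.Terminates := by
  obtain ⟨T, hT⟩ := h
  refine ⟨T, fun k hk u hen => hT (3 * k + 2) (by omega) u ⟨(s.simReady k u).mem_active,
    (s.simReady k u).guard, ?_⟩⟩
  rwa [(s.simReady k u).simView, (s.simReady k u).alg]

end SyncExecution

theorem mainTheorem4 {V : Type*} [Finite V] {Δ : ℕ} {Main Port Act : Type*}
    (A : SyncAlgorithm Δ Main Port Act) (x₀ : V → AlgState Δ Main Port) :
    (∀ e : SemiExecution A x₀, e.WeaklyFair →
      (∀ u i, ∃ t, (e.cfg t u).phase = i) ∧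
      (∀ r i, e.IsMinPhase r i → ∃ r', r < r' ∧ e.IsMinPhase r' (i + 1))) ∧
    ((∀ e : SyncExecution A x₀, e.Terminates) ↔
      ∀ e : SemiExecution A x₀, e.WeaklyFair → e.Terminates) :=
  ⟨fun _ hf => ⟨SemiExecution.exists_phase_eq hf,
      fun _ _ => SemiExecution.exists_isMinPhase_succ hf⟩,
    fun h e hf => SemiExecution.terminates_of_toSync hf (h (e.toSync hf)),
    fun h s => s.terminates_of_toSemi (h s.toSemi s.toSemi_weaklyFair)⟩
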